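/- Let $K$ be a finite extension of $\mathbf{Q}_p$ contained in $\mathbf{C}_p$, with ring of integers $\mathcal{O}_K$, a uniformizer $\pi$ and residue field of cardinality $q$. Let $\mathfrak{m}_{\mathbf{C}_p}$ be the open unit disk $\{u \in \mathbf{C}_p : |u| < 1\}$. For a power series $F(T) = \sum_{i \geq 1} f_i T^i \in T \cdot \mathcal{O}_K[[T]]$, let $\operatorname{wideg}(F)$ be the smallest $i$ such that $f_i \in \mathcal{O}_K^\times$ ($+\infty$ if there is none), and let $F^{\circ n}$ be the $n$-fold iterate of $F$ under composition, with $F^{\circ 0}(T) = T$. Let $\{F_\alpha(T)\}_{\alpha \in \mathcal{O}_K}$ be a family of power series in $T \cdot \mathcal{O}_K[[T]]$ such that $F_\alpha'(0) = \alpha$ and $F_\alpha \circ F_\beta = F_\beta \circ F_\alpha$ for all $\alpha, \beta \in \mathcal{O}_K$, and such that $\operatorname{wideg}(F_\pi) = q$. For $n \geq 1$, let $$\Lambda_n = \{ u \in \mathfrak{m}_{\mathbf{C}_p} : F_\pi^{\circ n}(u) = 0 \text{ and } F_\pi^{\circ (n-1)}(u) \neq 0 \}.$$ For $\alpha \in \mathcal{O}_K$,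 let $n(\alpha)$ be the largest integer $n \geq 0$ such that $\alpha \in 1 + \pi^n \mathcal{O}_K$, with $n(1) = +\infty$. Then for every $n \geq 1$: 1. for every $u \in \Lambda_n$ and $\alpha \in \mathcal{O}_K$, $F_\alpha(u) = u$ if and only if $n(\alpha) \geq n$, that is, $\alpha \in 1 + \pi^n \mathcal{O}_K$; 2. for every $\alpha \in \mathcal{O}_K$ with $n(\alpha) = n$, that is, $\alpha \in 1 + \pi^n \mathcal{O}_K$ and $\alpha \notin 1 + \pi^{n+1} \mathcal{O}_K$, $\operatorname{wideg}(F_\alpha(T) - T) = q^n$; 3. for every $u \in \Lambda_n$, $\Lambda_n = \{ F_\alpha(u) : \alpha \in \mathcal{O}_K^\times \}$. -/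

import Mathlib

open PowerSeries

noncomputable section

namespace LubinFamily

section General

variable {R : Type*} [CommRing R]

/-- The Weierstrass degree of a power series: the smallest `i` such that the coefficient of `T ^ i`
is a unit, and `⊤` if there is no such `i`. -/
def wideg (f : R⟦X⟧) : ℕ∞ :=
  sInf {m : ℕ∞ | ∃ i : ℕ, m = (i : ℕ∞) ∧ IsUnit (coeff i f)}

/-- The composition `f ∘ g (T) = f (g (T))` of power series (used when `g` has no constant term). -/
def comp (f g : R⟦X⟧) : R⟦X⟧ := PowerSeries.subst g f

/-- The `n`-fold iterate `f ∘ ⋯ ∘ f (T)`, with `0`-fold iterate `T`. -/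
def iter (f : R⟦X⟧) : ℕ → R⟦X⟧
  | 0 => X
  | n + 1 => comp f (iter f n)

/-- The set `1 + ϖ ^ n R`. -/
def onePlus (ϖ : R) (n : ℕ) : Set R := {α | ∃ β : R, α = 1 + ϖ ^ n * β}

/-- The largest `n ≥ 0` such that `α ∈ 1 + ϖ ^ n R`, and `⊤` if `α` is in all these sets. -/
def level (ϖ α : R) : ℕ∞ :=
  sSup {m : ℕ∞ | ∃ n : ℕ, m = (n : ℕ∞) ∧ α ∈ onePlus ϖ n}

end General

section Local

variable (p : ℕ) [Fact p.Prime] (K : Type*) [Field K] [Algebra ℚ_[p] K] [Algebra ℤ_[p] K]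

/-- The ring of integers of a finite extension `K` of `ℚ_p`: the integral closure of `ℤ_p`. -/
abbrev Integers : Type _ := integralClosure ℤ_[p] K

variable {K} in
theorem isIntegral_iff_spectralNorm_le_one [IsScalarTower ℤ_[p] ℚ_[p] K]
    [FiniteDimensional ℚ_[p] K] (x : K) :
    IsIntegral ℤ_[p] x ↔ spectralNorm ℚ_[p] K x ≤ 1 := by
  have hx : IsIntegral ℚ_[p] x := Algebra.IsIntegral.isIntegral x
  have hm := minpoly.monic hx
  rw [spectralNorm, spectralValue_le_one_iff hm]
  constructor
  · intro h n
    rw [minpoly.isIntegrallyClosed_eq_field_fractions' ℚ_[p] h, Polynomial.coeff_map]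
    exact PadicInt.norm_le_one _
  · intro h
    have hl : minpoly ℚ_[p] x ∈ Polynomial.lifts (algebraMap ℤ_[p] ℚ_[p]) := by
      rw [Polynomial.lifts_iff_coeff_lifts]
      exact fun n => ⟨⟨_, h n⟩, rfl⟩
    obtain ⟨g, hg, -, hgm⟩ := Polynomial.lifts_and_degree_eq_and_monic hl hm
    refine ⟨g, hgm, ?_⟩
    rw [← Polynomial.aeval_def, ← Polynomial.aeval_map_algebraMap ℚ_[p], hg, minpoly.aeval]

instance isLocalRing_integers [IsScalarTower ℤ_[p] ℚ_[p] K] [FiniteDimensional ℚ_[p] K] :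
    IsLocalRing (Integers p K) := by
  have key : ∀ x : Integers p K, spectralNorm ℚ_[p] K (x : K) = 1 → IsUnit x := by
    intro x hx
    have h0 : (x : K) ≠ 0 := by
      intro h
      rw [h, spectralNorm_zero] at hx
      exact zero_ne_one hx
    have hinv : spectralNorm ℚ_[p] K (x : K)⁻¹ = 1 := by
      have h := spectralAlgNorm_mul (K := ℚ_[p]) (L := K) (x : K) (x : K)⁻¹
      rw [mul_inv_cancel₀ h0] at h
      simp only [spectralAlgNorm_def, spectralNorm_one, hx, one_mul] at h
      exact h.symm
    refine IsUnit.of_mul_eq_one ⟨(x : K)⁻¹,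
      (isIntegral_iff_spectralNorm_le_one p _).2 hinv.le⟩ (Subtype.ext ?_)
    exact mul_inv_cancel₀ h0
  refine IsLocalRing.of_isUnit_or_isUnit_one_sub_self fun x => ?_
  have hx := (isIntegral_iff_spectralNorm_le_one p _).1 x.2
  have hy := (isIntegral_iff_spectralNorm_le_one p _).1 (1 - x : Integers p K).2
  by_contra! hcon
  have hx' := lt_of_le_of_ne hx fun h => hcon.1 (key _ h)
  have hy' := lt_of_le_of_ne hy fun h => hcon.2 (key _ h)
  have h := isNonarchimedean_spectralNorm (K := ℚ_[p]) (L := K) (x : K) (1 - x : Integers p K)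
  have h1 : (x : K) + ((1 - x : Integers p K) : K) = 1 := by push_cast; ring
  rw [h1, spectralNorm_one] at h
  exact absurd h (not_le.2 (max_lt hx' hy'))

/-- The cardinality `q` of the residue field of the ring of integers of `K`. -/
def residueCard [IsScalarTower ℤ_[p] ℚ_[p] K] [FiniteDimensional ℚ_[p] K] : ℕ :=
  Nat.card (IsLocalRing.ResidueField (Integers p K))

variable [Algebra K ℂ_[p]]

variable {K}

/-- The value `f (u) = ∑ aᵢ uⁱ` in `ℂ_p` of `f = ∑ aᵢ Tⁱ` with coefficients in the ring of integers
of `K`; the series converges for `u` in the open unit disk, where it is used. -/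
def eval (f : (Integers p K)⟦X⟧) (u : ℂ_[p]) : ℂ_[p] :=
  ∑' i : ℕ, algebraMap K ℂ_[p] (coeff i f : Integers p K) * u ^ i

/-- The points `u` of the maximal ideal of the ring of integers of `ℂ_p` such that the `n`-fold
iterate of `f` vanishes at `u` but the `(n - 1)`-fold iterate does not (used for `n ≥ 1`). -/
def levelSet (f : (Integers p K)⟦X⟧) (n : ℕ) : Set ℂ_[p] :=
  {u | ‖u‖ < 1 ∧ eval p (iter f n) u = 0 ∧ eval p (iter f (n - 1)) u ≠ 0}

end Local

/-- A family `F` of power series over `R`, indexed by `R`, such that `F α` has no constant term,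
`(F α)' (0) = α`, and the members of the family commute under composition. -/
structure IsCommutingFamily {R : Type*} [CommRing R] (F : R → R⟦X⟧) : Prop where
  constantCoeff_eq_zero : ∀ α, constantCoeff (F α) = 0
  coeff_one_eq : ∀ α, coeff 1 (F α) = α
  comm : ∀ α β, comp (F α) (F β) = comp (F β) (F α)

end LubinFamily

end

/-! Write `f` for `F ϖ`. A series without constant term that commutes with `f` is determined by its
linear coefficient, because `ϖ ^ n ≠ ϖ` for `n ≥ 2`; hence `F α ∘ F β = F (α * β)` and `F 1 = X`
(`comp_eq`, `apply_one`).

If `f = X * g`, then iterate `n + 1` is iterate `n` times `g` composed with iterate `n`. The second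
factor has constant coefficient `ϖ`, so its Weierstrass polynomial is Eisenstein. Its roots are the
points of exact level `n + 1`; they are conjugate and simple (`exists_iter_succ_factor`,
`exists_isLevelPoly`, `evalHom_derivative_iter_ne_zero`).

Let `α ≠ 1`. The fixed points of `F α` in the open disk are torsion, by contraction towards 0 under
`f`. They form whole levels by irreducibility, and the levels occurring are closed downwards because
`f` commutes with `F α`; so they are the zeros of a single iterate `j`. At each of them `F α` has
derivative `α`, so they are simple zeros of `F α - X`. Thus `F α - X` and iterate `j` have the same
Weierstrass polynomial: its degree gives `q ^ j`, and the linear coefficients show that `α - 1` is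
associated to `ϖ ^ j` (`exists_fixed_structure`). This yields the first two claims.

Weierstrass preparation needs `F α - X` to be nonzero modulo `ϖ` (`map_residue_sub_X_ne_zero`),
which rests on `f' ≡ 0` modulo `ϖ` (`map_residue_derivative_eq_zero`).

For the third claim, `α ↦ F α (u)` separates classes modulo `ϖ ^ n`, and there are as many classes
as zeros of iterate `n`; the units are the classes that reach exact level `n`
(`torsionLevel_eq_orbit`). -/

namespace LubinFamily

/-! ### The ring of integers as a complete discrete valuation ring -/

section IntegersOfLocalField

open IsLocalRing

theorem norm_algebraMap_eq_spectralNorm (p : ℕ) [Fact p.Prime] (K : Type*) [Field K]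
    [Algebra ℚ_[p] K] [FiniteDimensional ℚ_[p] K] [Algebra K ℂ_[p]] [IsScalarTower ℚ_[p] K ℂ_[p]]
    (x : K) : ‖algebraMap K ℂ_[p] x‖ = spectralNorm ℚ_[p] K x := by
  let f : AbsoluteValue K ℝ :=
    (NormedField.toAbsoluteValue ℂ_[p]).comp (algebraMap K ℂ_[p]).injective
  refine spectralNorm_unique_field_norm_ext (f := f) (fun y => ?_) x
  change ‖algebraMap K ℂ_[p] (algebraMap ℚ_[p] K y)‖ = ‖y‖
  rw [← IsScalarTower.algebraMap_apply]
  exact PadicComplex.norm_extends' p y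

variable (p : ℕ) [Fact p.Prime] (K : Type*) [Field K] [Algebra ℚ_[p] K] [Algebra ℤ_[p] K]
  [IsScalarTower ℤ_[p] ℚ_[p] K] [FiniteDimensional ℚ_[p] K]

theorem isIntegral_iff_norm_le_one [Algebra K ℂ_[p]] [IsScalarTower ℚ_[p] K ℂ_[p]] (x : K) :
    IsIntegral ℤ_[p] x ↔ ‖algebraMap K ℂ_[p] x‖ ≤ 1 := by
  rw [norm_algebraMap_eq_spectralNorm, isIntegral_iff_spectralNorm_le_one]

theorem isUnit_integers_iff [Algebra K ℂ_[p]] [IsScalarTower ℚ_[p] K ℂ_[p]] (x : Integers p K) :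
    IsUnit x ↔ ‖algebraMap K ℂ_[p] x‖ = 1 := by
  constructor
  · intro h
    obtain ⟨y, hy⟩ := h.exists_right_inv
    have h1 := (isIntegral_iff_norm_le_one p K _).1 x.2
    have h2 := (isIntegral_iff_norm_le_one p K _).1 y.2
    have h3 : ‖algebraMap K ℂ_[p] x‖ * ‖algebraMap K ℂ_[p] y‖ = 1 := by
      rw [← norm_mul, ← map_mul, ← Subalgebra.coe_mul, hy]
      simp
    nlinarith [norm_nonneg (algebraMap K ℂ_[p] x), norm_nonneg (algebraMap K ℂ_[p] y)]
  · intro h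
    have h0 : (x : K) ≠ 0 := by
      intro h0
      simp [h0] at h
    refine IsUnit.of_mul_eq_one ⟨(x : K)⁻¹, (isIntegral_iff_norm_le_one p _ _).2 ?_⟩
      (Subtype.ext (mul_inv_cancel₀ h0))
    rw [map_inv₀, norm_inv, h, inv_one]

theorem isDiscreteValuationRing_integers [Algebra K ℂ_[p]] [IsScalarTower ℚ_[p] K ℂ_[p]] :
    IsDiscreteValuationRing (Integers p K) := by
  have : Algebra.IsSeparable ℚ_[p] K := inferInstance
  have : IsDedekindDomain (Integers p K) := integralClosure.isDedekindDomain ℤ_[p] ℚ_[p] K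
  have hnf : ¬ IsField (Integers p K) := by
    intro h
    obtain ⟨y, hy⟩ := h.mul_inv_cancel (a := ((p : ℕ) : Integers p K)) (by
      intro h0
      have : ((p : ℕ) : K) = 0 := by
        simpa using congrArg (Subtype.val) h0
      have h1 : algebraMap ℚ_[p] K p = 0 := by simpa using this
      rw [_root_.map_eq_zero] at h1
      exact (Nat.Prime.ne_zero Fact.out) (by exact_mod_cast h1))
    have hu := (isUnit_integers_iff p K _).1 (IsUnit.of_mul_eq_one _ hy)
    have h1 : ((p : Integers p K) : K) = algebraMap ℚ_[p] K p := by simp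
    rw [h1, ← IsScalarTower.algebraMap_apply] at hu
    have h2 := PadicComplex.norm_extends' p (p : ℚ_[p])
    have h3 : ‖algebraMap ℚ_[p] ℂ_[p] p‖ = ‖(p : ℚ_[p])‖ := h2
    rw [h3] at hu
    exact (Padic.norm_p_lt_one (p := p)).ne hu
  have tfae := IsDiscreteValuationRing.TFAE (Integers p K) hnf
  exact (tfae.out 0 2).2 this

theorem isAdicComplete_integers [Algebra K ℂ_[p]] [IsScalarTower ℚ_[p] K ℂ_[p]] :
    IsAdicComplete (maximalIdeal (Integers p K)) (Integers p K) := by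
  have := isDiscreteValuationRing_integers p K
  obtain ⟨ϖ, hϖ⟩ := IsDiscreteValuationRing.exists_irreducible (Integers p K)
  have hle (x : Integers p K) : ‖algebraMap K ℂ_[p] x‖ ≤ 1 :=
    (isIntegral_iff_norm_le_one p K _).1 x.2
  have hϖ1 : ‖algebraMap K ℂ_[p] ϖ‖ < 1 :=
    lt_of_le_of_ne (hle ϖ) fun h => hϖ.not_isUnit ((isUnit_integers_iff p K ϖ).2 h)
  have hϖ0 : (ϖ : K) ≠ 0 := fun h => hϖ.ne_zero (Subtype.ext h)
  have hϖn : algebraMap K ℂ_[p] ϖ ≠ 0 := by simpa using hϖ0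
  have hmem (n : ℕ) (x : Integers p K) : x ∈ maximalIdeal (Integers p K) ^ n ↔
      ‖algebraMap K ℂ_[p] x‖ ≤ ‖algebraMap K ℂ_[p] ϖ‖ ^ n := by
    rw [hϖ.maximalIdeal_eq, Ideal.span_singleton_pow, Ideal.mem_span_singleton]
    constructor
    · rintro ⟨y, rfl⟩
      rw [Subalgebra.coe_mul, Subalgebra.coe_pow, map_mul, map_pow, norm_mul, norm_pow]
      exact mul_le_of_le_one_right (by positivity) (hle y)
    · intro h
      refine ⟨⟨(x : K) / (ϖ : K) ^ n, (isIntegral_iff_norm_le_one p K _).2 ?_⟩, Subtype.ext ?_⟩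
      · rw [map_div₀, map_pow, norm_div, norm_pow]
        exact div_le_one_of_le₀ h (by positivity)
      · push_cast
        field_simp
  have hprec : IsPrecomplete (maximalIdeal (Integers p K)) (Integers p K) := by
    constructor
    intro f hf
    simp only [smul_eq_mul, Ideal.mul_top, SModEq.sub_mem, hmem] at hf ⊢
    -- The image of `K` is finite-dimensional over `ℚ_[p]`, hence closed: limits taken in `ℂ_[p]`
    -- come back to `K`.
    let V := LinearMap.range (IsScalarTower.toAlgHom ℚ_[p] K ℂ_[p]).toLinearMap
    have hV : IsClosed (V : Set ℂ_[p]) := V.closed_of_finiteDimensional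
    let g : ℕ → ℂ_[p] := fun n => algebraMap K ℂ_[p] (f n)
    have hg {m n : ℕ} (h : m ≤ n) : ‖g m - g n‖ ≤ ‖algebraMap K ℂ_[p] ϖ‖ ^ m := by
      simpa only [Subalgebra.coe_sub, map_sub] using hf h
    have ht := tendsto_pow_atTop_nhds_zero_of_lt_one (norm_nonneg _) hϖ1
    have hc : CauchySeq g := by
      refine cauchySeq_of_le_tendsto_0 (fun n => 2 * ‖algebraMap K ℂ_[p] ϖ‖ ^ n) ?_
        (by simpa using ht.const_mul 2)
      intro a b N ha hb
      rw [dist_eq_norm]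
      have h1 := hg ha
      have h2 := hg hb
      calc ‖g a - g b‖ = ‖(g N - g b) - (g N - g a)‖ := by congr 1; ring
        _ ≤ ‖g N - g b‖ + ‖g N - g a‖ := norm_sub_le _ _
        _ ≤ _ := by linarith
    obtain ⟨L, hL⟩ := cauchySeq_tendsto_of_complete hc
    obtain ⟨x, hx⟩ : L ∈ V := hV.mem_of_tendsto hL (Filter.Eventually.of_forall fun n => ⟨f n, rfl⟩)
    have hx' : algebraMap K ℂ_[p] x = L := hx
    have hxi : IsIntegral ℤ_[p] x := by
      rw [isIntegral_iff_norm_le_one p K, hx']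
      exact le_of_tendsto hL.norm (Filter.Eventually.of_forall fun n => hle (f n))
    refine ⟨⟨x, hxi⟩, fun n => ?_⟩
    rw [Subalgebra.coe_sub, map_sub, hx']
    exact le_of_tendsto (tendsto_const_nhds.sub hL).norm
      ((Filter.eventually_ge_atTop n).mono fun m hm => hg hm)
  have : IsHausdorff (maximalIdeal (Integers p K)) (Integers p K) := inferInstance
  exact { }

end IntegersOfLocalField

/-! ### Evaluation of power series on the open unit disk -/

open IsLocalRing

/-- `C` is a normed algebra over the local ring `O` whose elements map into the closed unit ball,
the maximal ideal mapping into the open unit ball. -/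
class IsBounded (O C : Type*) [CommRing O] [IsLocalRing O] [NormedField C] [Algebra O C] :
    Prop where
  norm_le_one : ∀ x : O, ‖algebraMap O C x‖ ≤ 1
  norm_lt_one : ∀ x ∈ maximalIdeal O, ‖algebraMap O C x‖ < 1

section Definition

variable {O C : Type*} [CommRing O] [NormedField C] [Algebra O C]

/-- The value `∑ aᵢ uⁱ` of the power series `∑ aᵢ Tⁱ` at `u`. -/
noncomputable def evalAt (f : O⟦X⟧) (u : C) : C := ∑' i : ℕ, algebraMap O C (coeff i f) * u ^ i

end Definition

section Polynomials

variable {O C : Type*} [CommRing O] [NormedField C] [Algebra O C]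

theorem evalAt_coe (P : Polynomial O) (u : C) : evalAt (P : O⟦X⟧) u = Polynomial.aeval u P := by
  rw [evalAt, Polynomial.aeval_eq_sum_range, tsum_eq_sum (s := Finset.range (P.natDegree + 1))]
  · simp [Algebra.smul_def]
  · intro i hi
    rw [Polynomial.coeff_coe, Polynomial.coeff_eq_zero_of_natDegree_lt, map_zero, zero_mul]
    simpa [Nat.lt_succ_iff] using hi

theorem evalAt_zero (f : O⟦X⟧) : evalAt f (0 : C) = algebraMap O C (constantCoeff f) := by
  rw [evalAt, tsum_eq_single 0]
  · simp
  · intro i hi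
    simp [hi]

theorem evalAt_X {u : C} : evalAt (X : O⟦X⟧) u = u := by
  simpa using evalAt_coe (O := O) Polynomial.X u

end Polynomials

section Evaluation

variable {O C : Type*} [CommRing O] [IsLocalRing O] [NormedField C] [Algebra O C] [IsBounded O C]

theorem norm_term_le (f : O⟦X⟧) (u : C) (i : ℕ) :
    ‖algebraMap O C (coeff i f) * u ^ i‖ ≤ ‖u‖ ^ i := by
  rw [norm_mul, norm_pow]
  exact mul_le_of_le_one_left (by positivity) (IsBounded.norm_le_one _)

theorem summable_norm_term (f : O⟦X⟧) {u : C} (hu : ‖u‖ < 1) :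
    Summable fun i => ‖algebraMap O C (coeff i f) * u ^ i‖ :=
  Summable.of_nonneg_of_le (fun _ => norm_nonneg _) (norm_term_le f u)
    (summable_geometric_of_lt_one (norm_nonneg _) hu)

variable [CompleteSpace C]

theorem summable_term (f : O⟦X⟧) {u : C} (hu : ‖u‖ < 1) :
    Summable fun i => algebraMap O C (coeff i f) * u ^ i :=
  (summable_norm_term f hu).of_norm

theorem evalAt_add (f g : O⟦X⟧) {u : C} (hu : ‖u‖ < 1) :
    evalAt (f + g) u = evalAt f u + evalAt g u := by
  have h := (summable_term f hu).hasSum.add (summable_term g hu).hasSum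
  rw [evalAt, evalAt, evalAt, ← h.tsum_eq]
  refine tsum_congr fun i => ?_
  rw [map_add, map_add, add_mul]

theorem evalAt_mul (f g : O⟦X⟧) {u : C} (hu : ‖u‖ < 1) :
    evalAt (f * g) u = evalAt f u * evalAt g u := by
  have h := tsum_mul_tsum_eq_tsum_sum_antidiagonal_of_summable_norm
    (f := fun i => algebraMap O C (coeff i f) * u ^ i)
    (g := fun i => algebraMap O C (coeff i g) * u ^ i)
    (summable_norm_term f hu) (summable_norm_term g hu)
  rw [evalAt, evalAt, evalAt, h]
  refine tsum_congr fun n => ?_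
  rw [coeff_mul, map_sum, Finset.sum_mul]
  refine Finset.sum_congr rfl fun ij hij => ?_
  rw [← Finset.HasAntidiagonal.mem_antidiagonal.1 hij, map_mul, pow_add]
  ring

/-- Evaluation at a point of the open unit disk, as a ring homomorphism. -/
noncomputable def evalHom {u : C} (hu : ‖u‖ < 1) : O⟦X⟧ →+* C where
  toFun f := evalAt f u
  map_one' := by simpa using evalAt_coe (O := O) 1 u
  map_zero' := by simp [evalAt]
  map_add' f g := evalAt_add f g hu
  map_mul' f g := evalAt_mul f g hu

variable {u : C} (hu : ‖u‖ < 1)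

theorem evalHom_apply (f : O⟦X⟧) : evalHom hu f = evalAt f u := rfl

theorem evalHom_coe (P : Polynomial O) : evalHom hu (P : O⟦X⟧) = Polynomial.aeval u P :=
  evalAt_coe P u

@[simp] theorem evalHom_X : evalHom hu (X : O⟦X⟧) = u := by
  simpa using evalHom_coe (O := O) hu Polynomial.X

@[simp] theorem evalHom_C (a : O) : evalHom hu (PowerSeries.C a : O⟦X⟧) = algebraMap O C a := by
  simpa using evalHom_coe (O := O) hu (Polynomial.C a)

theorem evalHom_ne_zero_of_isUnit {f : O⟦X⟧} (hf : IsUnit f) : evalHom hu f ≠ 0 :=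
  (hf.map (evalHom hu)).ne_zero

variable [IsUltrametricDist C]

theorem norm_evalHom_le_one (f : O⟦X⟧) : ‖evalHom hu f‖ ≤ 1 := by
  rw [evalHom_apply, evalAt]
  refine IsUltrametricDist.norm_tsum_le_of_forall_le_of_nonneg zero_le_one fun i => ?_
  exact (norm_term_le f u i).trans (pow_le_one₀ (norm_nonneg _) hu.le)

theorem norm_evalHom_le {f : O⟦X⟧} (hf : constantCoeff f = 0) : ‖evalHom hu f‖ ≤ ‖u‖ := by
  obtain ⟨g, rfl⟩ := X_dvd_iff.2 hf
  rw [map_mul, evalHom_X, norm_mul]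
  exact mul_le_of_le_one_right (norm_nonneg _) (norm_evalHom_le_one hu g)

theorem norm_evalHom_lt_one {f : O⟦X⟧} (hf : constantCoeff f = 0) : ‖evalHom hu f‖ < 1 :=
  (norm_evalHom_le hu hf).trans_lt hu

/-- The double series with terms `c i k` may be summed in either order: `c i k` has norm at most
`‖u‖ ^ k` and vanishes for `k < i`, so the norms in row `k` add up to at most `(k + 1) * ‖u‖ ^ k`.
-/
theorem evalHom_comp (f : O⟦X⟧) {g : O⟦X⟧} (hg : constantCoeff g = 0) :
    evalHom hu (comp f g) = evalHom (norm_evalHom_lt_one hu hg) f := by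
  have hs : HasSubst g := HasSubst.of_constantCoeff_zero' hg
  let c : ℕ → ℕ → C := fun i k => algebraMap O C (coeff i f * coeff k (g ^ i)) * u ^ k
  have hzero (i k : ℕ) (h : k < i) : coeff k (g ^ i) = 0 := by
    obtain ⟨g', rfl⟩ := X_dvd_iff.2 hg
    rw [mul_pow, coeff_X_pow_mul', if_neg (by omega)]
  have hbound (i k : ℕ) : ‖c i k‖ ≤ ‖u‖ ^ k := by
    simp only [c, norm_mul, norm_pow]
    exact mul_le_of_le_one_left (by positivity) (IsBounded.norm_le_one _)
  have hsum : Summable (Function.uncurry fun k i => c i k) := by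
    refine Summable.of_norm ?_
    refine (summable_prod_of_nonneg fun _ => norm_nonneg _).2 ⟨fun k => ?_, ?_⟩
    · refine summable_of_ne_finset_zero (s := Finset.range (k + 1)) fun i hi => ?_
      simp [c, hzero i k (by simpa using hi)]
    · have h1 : Summable fun k : ℕ => ((k : ℝ) + 1) * ‖u‖ ^ k := by
        have h2 := summable_pow_mul_geometric_of_norm_lt_one 1 (r := ‖u‖) (by simpa using hu)
        have h3 := summable_geometric_of_lt_one (norm_nonneg _) hu
        simpa [add_mul] using h2.add h3
      refine Summable.of_nonneg_of_le (fun k => tsum_nonneg fun i => norm_nonneg _) (fun k => ?_) h1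
      rw [tsum_eq_sum (s := Finset.range (k + 1))]
      · refine (Finset.sum_le_sum fun i _ => hbound i k).trans ?_
        simp
      · intro i hi
        simp [c, hzero i k (by simpa using hi)]
  have hl : evalHom hu (comp f g) = ∑' k, ∑' i, c i k := by
    rw [evalHom_apply, evalAt]
    refine tsum_congr fun k => ?_
    rw [comp, coeff_subst' hs, tsum_eq_sum (s := Finset.range (k + 1)),
      finsum_eq_sum_of_support_subset (s := Finset.range (k + 1)), map_sum, Finset.sum_mul]
    · rfl
    · intro i hi
      by_contra h
      exact hi (by simp [hzero i k (by simpa using h)])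
    · intro i hi
      simp [c, hzero i k (by simpa using hi)]
  rw [hl, evalHom_apply, evalAt, ← hsum.tsum_comm' (fun k => hsum.prod_factor k) fun i => ?_]
  · refine tsum_congr fun i => ?_
    rw [← map_pow, evalHom_apply, evalAt, ← tsum_mul_left]
    refine tsum_congr fun k => ?_
    simp only [c, map_mul, mul_assoc]
  · exact Summable.of_norm_bounded (summable_geometric_of_lt_one (norm_nonneg _) hu) (hbound i)

end Evaluation

/-! ### Composition and iteration of power series -/

section Composition

variable {R : Type*} [CommRing R]

theorem comp_X_left {g : R⟦X⟧} (hg : constantCoeff g = 0) : comp X g = g :=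
  subst_X (HasSubst.of_constantCoeff_zero' hg)

theorem comp_X_right (f : R⟦X⟧) : comp f X = f := X_subst f

theorem comp_C (a : R) {g : R⟦X⟧} : comp (C a) g = C a := subst_C a

theorem comp_add (f₁ f₂ : R⟦X⟧) {g : R⟦X⟧} (hg : constantCoeff g = 0) :
    comp (f₁ + f₂) g = comp f₁ g + comp f₂ g :=
  subst_add (HasSubst.of_constantCoeff_zero' hg) _ _

theorem comp_sub (f₁ f₂ : R⟦X⟧) {g : R⟦X⟧} (hg : constantCoeff g = 0) :
    comp (f₁ - f₂) g = comp f₁ g - comp f₂ g :=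
  subst_sub (HasSubst.of_constantCoeff_zero' hg) _ _

theorem comp_mul (f₁ f₂ : R⟦X⟧) {g : R⟦X⟧} (hg : constantCoeff g = 0) :
    comp (f₁ * f₂) g = comp f₁ g * comp f₂ g :=
  subst_mul (HasSubst.of_constantCoeff_zero' hg) _ _

theorem comp_X_pow_mul (n : ℕ) (f : R⟦X⟧) {g : R⟦X⟧} (hg : constantCoeff g = 0) :
    comp (X ^ n * f) g = g ^ n * comp f g := by
  rw [comp_mul _ _ hg, comp, subst_pow (HasSubst.of_constantCoeff_zero' hg),
    subst_X (HasSubst.of_constantCoeff_zero' hg)]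

theorem comp_assoc (f : R⟦X⟧) {g h : R⟦X⟧} (hg : constantCoeff g = 0) (hh : constantCoeff h = 0) :
    comp (comp f g) h = comp f (comp g h) :=
  subst_comp_subst_apply (HasSubst.of_constantCoeff_zero' hg)
    (HasSubst.of_constantCoeff_zero' hh) f

theorem constantCoeff_comp (f : R⟦X⟧) {g : R⟦X⟧} (hg : constantCoeff g = 0) :
    constantCoeff (comp f g) = constantCoeff f := by
  obtain ⟨f', hf⟩ := X_dvd_iff.2 (show constantCoeff (f - C (constantCoeff f)) = 0 by simp)
  rw [sub_eq_iff_eq_add] at hf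
  rw [hf, comp_add _ _ hg, comp_mul _ _ hg, comp_X_left hg, comp_C]
  simp [hg]

theorem coeff_comp_X_pow_mul (n : ℕ) (f : R⟦X⟧) {g : R⟦X⟧} (hg : constantCoeff g = 0) :
    coeff n (comp (X ^ n * f) g) = coeff 1 g ^ n * constantCoeff f := by
  rw [comp_X_pow_mul n f hg]
  obtain ⟨g', hg'⟩ := X_dvd_iff.2 hg
  have h1 : coeff 1 g = constantCoeff g' := by
    rw [hg', show (1 : ℕ) = 0 + 1 from rfl, coeff_succ_X_mul, coeff_zero_eq_constantCoeff_apply]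
  have h2 := constantCoeff_comp f hg
  rw [h1, ← h2]
  generalize comp f g = c
  rw [hg', mul_pow, mul_assoc]
  have := coeff_X_pow_mul (g' ^ n * c) n 0
  rw [zero_add] at this
  rw [this]
  simp

theorem coeff_one_comp {f g : R⟦X⟧} (hf : constantCoeff f = 0) (hg : constantCoeff g = 0) :
    coeff 1 (comp f g) = coeff 1 f * coeff 1 g := by
  obtain ⟨f', rfl⟩ := X_dvd_iff.2 hf
  have := coeff_comp_X_pow_mul 1 f' hg
  rw [pow_one, pow_one] at this
  rw [this, show (1 : ℕ) = 0 + 1 from rfl, coeff_succ_X_mul, coeff_zero_eq_constantCoeff_apply,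
    mul_comm]

theorem derivative_comp (f : R⟦X⟧) {g : R⟦X⟧} (hg : constantCoeff g = 0) :
    derivative R (comp f g) = comp (derivative R f) g * derivative R g :=
  derivative_subst (HasSubst.of_constantCoeff_zero' hg)

theorem constantCoeff_derivative (f : R⟦X⟧) : constantCoeff (derivative R f) = coeff 1 f := by
  rw [← coeff_zero_eq_constantCoeff_apply, coeff_derivative]
  simp

theorem map_comp {S : Type*} [CommRing S] (φ : R →+* S) (f : R⟦X⟧) {g : R⟦X⟧}
    (hg : constantCoeff g = 0) : map φ (comp f g) = comp (map φ f) (map φ g) :=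
  map_subst (HasSubst.of_constantCoeff_zero' hg) f

theorem coeff_comp_sub_comp (f : R⟦X⟧) {a b : R⟦X⟧} (ha : constantCoeff a = 0)
    (hb : constantCoeff b = 0) (k : ℕ) :
    coeff k (comp f a - comp f b) = ∑ᶠ i, coeff i f * coeff k (a ^ i - b ^ i) := by
  have ha' := HasSubst.of_constantCoeff_zero' ha
  have hb' := HasSubst.of_constantCoeff_zero' hb
  rw [map_sub, comp, comp, coeff_subst' ha', coeff_subst' hb',
    ← finsum_sub_distrib (coeff_subst_finite' ha' f k) (coeff_subst_finite' hb' f k)]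
  refine finsum_congr fun i => ?_
  rw [smul_eq_mul, smul_eq_mul, map_sub, mul_sub]

/-- For `i ≥ 2` the cofactor of `a - b` in `a ^ i - b ^ i` is divisible by `X`, so only the linear
term of `f` reaches degree `n`. -/
theorem coeff_comp_sub_comp_of_dvd (f : R⟦X⟧) {a b : R⟦X⟧} (ha : constantCoeff a = 0)
    (hb : constantCoeff b = 0) {n : ℕ} (h : X ^ n ∣ a - b) :
    coeff n (comp f a - comp f b) = coeff 1 f * coeff n (a - b) := by
  rw [coeff_comp_sub_comp f ha hb, finsum_eq_single _ 1]
  · simp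
  intro i hi
  rcases Nat.lt_or_gt_of_ne hi with h0 | h2
  · simp [Nat.lt_one_iff.1 h0]
  have hd : X ^ (n + 1) ∣ a ^ i - b ^ i := by
    rw [← (Commute.all a b).mul_geom_sum₂ i, pow_succ]
    refine mul_dvd_mul h (Finset.dvd_sum fun j hj => ?_)
    rcases Nat.eq_zero_or_pos j with rfl | hj0
    · exact Dvd.dvd.mul_left (dvd_pow (X_dvd_iff.2 hb) (by omega)) _
    · exact Dvd.dvd.mul_right (dvd_pow (X_dvd_iff.2 ha) (by omega)) _
  rw [X_pow_dvd_iff.1 hd n (by omega), mul_zero]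

/-- A power series without constant term that commutes with `f` is determined by its linear
coefficient. -/
theorem eq_of_comp_comm [IsDomain R] {f g h : R⟦X⟧} (hf : constantCoeff f = 0)
    (hf1 : ∀ n, 2 ≤ n → coeff 1 f ^ n ≠ coeff 1 f)
    (hg : constantCoeff g = 0) (hh : constantCoeff h = 0) (hfg : comp f g = comp g f)
    (hfh : comp f h = comp h f) (h1 : coeff 1 g = coeff 1 h) : g = h := by
  ext n
  induction n using Nat.strong_induction_on with
  | _ n ih =>
    rcases Nat.lt_or_ge n 2 with hn | hn
    · interval_cases n
      · simpa using hg.trans hh.symm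
      · exact h1
    have hd : X ^ n ∣ g - h := X_pow_dvd_iff.2 fun m hm => by rw [map_sub, ih m hm, sub_self]
    have e1 := coeff_comp_sub_comp_of_dvd f hg hh hd
    obtain ⟨e, he⟩ := hd
    rw [hfg, hfh, ← comp_sub _ _ hf, he, coeff_comp_X_pow_mul n e hf, mul_comm] at e1
    have e2 : coeff n (X ^ n * e) = constantCoeff e := by
      simpa using coeff_X_pow_mul e n 0
    rw [e2] at e1
    -- The degree `n` coefficient of `f ∘ g - f ∘ h = (g - h) ∘ f` has been computed from both
    -- sides.
    have e3 : (coeff 1 f ^ n - coeff 1 f) * constantCoeff e = 0 := by linear_combination e1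
    have e4 := (mul_eq_zero.1 e3).resolve_left (sub_ne_zero.2 (hf1 n hn))
    rw [← sub_eq_zero, ← map_sub, he, e2, e4]

theorem order_comp [IsDomain R] {f g : R⟦X⟧} (hg : constantCoeff g = 0) {a : ℕ}
    (hf : f.order = a) : (comp f g).order = a * g.order := by
  obtain ⟨v, rfl⟩ := X_pow_dvd_iff.2 fun m hm => coeff_of_lt_order (φ := f) m (by
    rw [hf]; exact_mod_cast hm)
  have hv : constantCoeff v ≠ 0 := by
    have h := coeff_order (φ := X ^ a * v) (by
      intro h
      rw [h, order_zero] at hf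
      exact ENat.top_ne_natCast a hf)
    rw [hf, ENat.toNat_natCast] at h
    have e2 : coeff a (X ^ a * v) = constantCoeff v := by
      simpa using coeff_X_pow_mul v a 0
    rwa [e2] at h
  have hv' : (comp v g).order = 0 := by
    by_contra h
    exact hv ((constantCoeff_comp v hg).symm.trans (order_ne_zero_iff_constCoeff_eq_zero.1 h))
  rw [comp_X_pow_mul a v hg, order_mul, order_pow, hv', add_zero, nsmul_eq_mul]

end Composition

section Iterates

variable {R : Type*} [CommRing R] {f : R⟦X⟧}

theorem constantCoeff_iter (hf : constantCoeff f = 0) (n : ℕ) : constantCoeff (iter f n) = 0 := by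
  induction n with
  | zero => exact constantCoeff_X
  | succ n ih => rw [iter, constantCoeff_comp f ih, hf]

theorem iter_one : iter f 1 = f := comp_X_right f

theorem iter_succ' (hf : constantCoeff f = 0) (n : ℕ) : iter f (n + 1) = comp (iter f n) f := by
  induction n with
  | zero => rw [iter_one, iter, comp_X_left hf]
  | succ n ih =>
    calc iter f (n + 1 + 1) = comp f (comp (iter f n) f) := by rw [← ih]; rfl
      _ = comp (iter f (n + 1)) f := (comp_assoc f (constantCoeff_iter hf n) hf).symm

theorem comp_iter_comm (hf : constantCoeff f = 0) {g : R⟦X⟧} (hg : constantCoeff g = 0)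
    (hgf : comp g f = comp f g)
    (n : ℕ) :
    comp g (iter f n) = comp (iter f n) g := by
  induction n with
  | zero => rw [iter, comp_X_left hg, comp_X_right]
  | succ n ih =>
    rw [iter, ← comp_assoc g hf (constantCoeff_iter hf n), hgf,
      comp_assoc f hg (constantCoeff_iter hf n), ih, comp_assoc f (constantCoeff_iter hf n) hg]

end Iterates

/-! ### Weierstrass degree as order of the reduction -/

section Residue

variable {O : Type*} [CommRing O] [IsLocalRing O]

theorem coeff_map_residue_ne_zero_iff (f : O⟦X⟧) (i : ℕ) :
    coeff i (map (residue O) f) ≠ 0 ↔ IsUnit (coeff i f) := by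
  rw [coeff_map, residue_ne_zero_iff_isUnit]

theorem wideg_eq_order (f : O⟦X⟧) : wideg f = (map (residue O) f).order := by
  refine le_antisymm ?_ (le_sInf ?_)
  · rcases eq_or_ne (map (residue O) f) 0 with h | h
    · rw [h, order_zero]
      exact le_top
    · refine sInf_le ⟨(map (residue O) f).order.toNat,
        (ENat.natCast_toNat (order_finite_iff_ne_zero.2 h).ne).symm, ?_⟩
      exact (coeff_map_residue_ne_zero_iff f _).1 (coeff_order h)
  · rintro m ⟨i, rfl, hi⟩
    exact order_le i ((coeff_map_residue_ne_zero_iff f i).2 hi)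

end Residue

theorem C_dvd_iff_map_residue_eq_zero {O : Type*} [CommRing O] [IsDomain O]
    [IsDiscreteValuationRing O] {ϖ : O} (hϖ : Irreducible ϖ) (f : O⟦X⟧) :
    C ϖ ∣ f ↔ map (residue O) f = 0 := by
  have h (i : ℕ) : coeff i (map (residue O) f) = 0 ↔ ϖ ∣ coeff i f := by
    rw [coeff_map, residue_eq_zero_iff, hϖ.maximalIdeal_eq, Ideal.mem_span_singleton]
  constructor
  · rintro ⟨g, rfl⟩
    ext i
    rw [map_zero, h, coeff_C_mul]
    exact dvd_mul_right _ _
  · intro h0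
    choose g hg using fun i => (h i).1 (by rw [h0, map_zero])
    refine ⟨mk g, ?_⟩
    ext i
    rw [coeff_C_mul, coeff_mk, hg]

/-! ### Roots of polynomials and Weierstrass factors -/

section Roots

variable {O C : Type*} [CommRing O] [NormedField C] [Algebra O C]

theorem ncard_setOf_aeval_eq_zero [IsAlgClosed C] {P : Polynomial O} (hP : P.Monic)
    (hPn : (P.map (algebraMap O C)).roots.Nodup) :
    {u : C | Polynomial.aeval u P = 0}.ncard = P.natDegree ∧
      {u : C | Polynomial.aeval u P = 0}.Finite := by
  classical
  have hs : {u : C | Polynomial.aeval u P = 0} =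
      ((P.map (algebraMap O C)).roots.toFinset : Set C) := by
    ext u
    simp [Polynomial.mem_roots (hP.map _).ne_zero, Polynomial.eval_map_algebraMap]
  rw [hs, Set.ncard_coe_finset, Multiset.toFinset_card_of_nodup hPn,
    ← (IsAlgClosed.splits (P.map (algebraMap O C))).natDegree_eq_card_roots, hP.natDegree_map]
  exact ⟨rfl, Finset.finite_toSet _⟩

variable [FaithfulSMul O C]

theorem nodup_roots_map {P : Polynomial O} (hP : P ≠ 0)
    (h : ∀ u : C, Polynomial.aeval u P = 0 → Polynomial.aeval u (Polynomial.derivative P) ≠ 0) :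
    (P.map (algebraMap O C)).roots.Nodup := by
  classical
  rw [Multiset.nodup_iff_count_le_one]
  intro u
  rw [Polynomial.count_roots]
  by_contra! hlt
  have hP' : P.map (algebraMap O C) ≠ 0 :=
    (Polynomial.map_ne_zero_iff (FaithfulSMul.algebraMap_injective O C)).2 hP
  have h1 := (Polynomial.one_lt_rootMultiplicity_iff_isRoot hP').1 hlt
  refine h u ?_ ?_
  · rw [← Polynomial.eval_map_algebraMap]
    exact h1.1
  · rw [← Polynomial.eval_map_algebraMap, ← Polynomial.derivative_map]
    exact h1.2

theorem eq_of_nodup_roots [IsAlgClosed C] {P Q : Polynomial O} (hP : P.Monic) (hQ : Q.Monic)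
    (hPn : (P.map (algebraMap O C)).roots.Nodup) (hQn : (Q.map (algebraMap O C)).roots.Nodup)
    (h : ∀ u : C, Polynomial.aeval u P = 0 ↔ Polynomial.aeval u Q = 0) : P = Q := by
  refine Polynomial.map_injective _ (FaithfulSMul.algebraMap_injective O C) ?_
  have hr : (P.map (algebraMap O C)).roots = (Q.map (algebraMap O C)).roots := by
    refine (Multiset.Nodup.ext hPn hQn).2 fun u => ?_
    rw [Polynomial.mem_roots (hP.map _).ne_zero, Polynomial.mem_roots (hQ.map _).ne_zero,
      Polynomial.IsRoot.def, Polynomial.IsRoot.def, Polynomial.eval_map_algebraMap,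
      Polynomial.eval_map_algebraMap, h]
  rw [(IsAlgClosed.splits (P.map (algebraMap O C))).eq_prod_roots_of_monic (hP.map _), hr,
    ← (IsAlgClosed.splits (Q.map (algebraMap O C))).eq_prod_roots_of_monic (hQ.map _)]

variable [IsDomain O]

theorem dvd_of_aeval_eq_zero [IsIntegrallyClosed O] {P Q : Polynomial O} (hP : P.Monic)
    (hirr : Irreducible P) {u : C} (hu : Polynomial.aeval u P = 0)
    (hQ : Polynomial.aeval u Q = 0) : P ∣ Q := by
  have hint : IsIntegral O u := ⟨P, hP, hu⟩
  have h1 := minpoly.isIntegrallyClosed_dvd hint hu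
  have h2 := minpoly.isIntegrallyClosed_dvd hint hQ
  obtain ⟨R, hR⟩ := h1
  rcases hirr.isUnit_or_isUnit hR with h | h
  · exact absurd h (minpoly.not_isUnit O u)
  · rw [hR]
    exact (h.mul_right_dvd).2 h2

theorem aeval_derivative_ne_zero [IsIntegrallyClosed O] [CharZero O] {P : Polynomial O}
    (hP : P.Monic) (hirr : Irreducible P) {u : C} (hu : Polynomial.aeval u P = 0) :
    Polynomial.aeval u (Polynomial.derivative P) ≠ 0 := by
  intro h
  have hd := dvd_of_aeval_eq_zero hP hirr hu h
  have hdeg : P.natDegree ≠ 0 := by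
    intro h0
    rw [hP.natDegree_eq_zero.1 h0] at hirr
    exact hirr.not_isUnit isUnit_one
  have hlt := Polynomial.natDegree_derivative_lt hdeg
  have h0 := Polynomial.eq_zero_of_dvd_of_natDegree_lt hd hlt
  exact hdeg (Polynomial.derivative_eq_zero.1 h0)

end Roots

section Weierstrass

variable {O C : Type*} [CommRing O] [IsLocalRing O] [NormedField C] [Algebra O C] [IsBounded O C]

/-- If `‖u‖ ≥ 1`, the leading term strictly dominates all others, whose coefficients have norm less
than 1, so they cannot cancel it. -/
theorem norm_lt_one_of_aeval_eq_zero [IsUltrametricDist C] {P : Polynomial O}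
    (hP : P.IsDistinguishedAt (maximalIdeal O)) {u : C} (hu : Polynomial.aeval u P = 0) :
    ‖u‖ < 1 := by
  by_contra! h1
  have hpos : 0 < ‖u‖ := one_pos.trans_le h1
  rw [Polynomial.aeval_eq_sum_range, Finset.sum_range_succ, hP.monic.coeff_natDegree,
    one_smul] at hu
  have h2 : ‖u‖ ^ P.natDegree = ‖∑ i ∈ Finset.range P.natDegree, P.coeff i • u ^ i‖ := by
    rw [← norm_pow, eq_neg_of_add_eq_zero_right hu, norm_neg]
  have hne : (Finset.range P.natDegree).Nonempty := by
    rw [Finset.nonempty_iff_ne_empty]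
    intro h
    rw [h] at h2
    simp at h2
    simp [h2] at hpos
  obtain ⟨i, hi, hle⟩ := IsUltrametricDist.exists_norm_finsetSum_le_of_nonempty hne
    (fun i => P.coeff i • u ^ i)
  rw [← h2, Algebra.smul_def, norm_mul, norm_pow] at hle
  have hi' := Finset.mem_range.1 hi
  have h3 := IsBounded.norm_lt_one (C := C) _ (hP.mem hi')
  have h4 : ‖u‖ ^ i ≤ ‖u‖ ^ P.natDegree := pow_le_pow_right₀ h1 hi'.le
  have h5 : 0 < ‖u‖ ^ i := pow_pos hpos i
  nlinarith

variable [CompleteSpace C]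

theorem evalHom_eq_zero_iff {g U : O⟦X⟧} {P : Polynomial O}
    (H : g.IsWeierstrassFactorization P U) {u : C} (hu : ‖u‖ < 1) :
    evalHom hu g = 0 ↔ Polynomial.aeval u P = 0 := by
  rw [H.eq_mul, map_mul, evalHom_coe, mul_eq_zero, or_iff_left]
  exact evalHom_ne_zero_of_isUnit hu H.isUnit

theorem evalHom_derivative_eq {g U : O⟦X⟧} {P : Polynomial O}
    (H : g.IsWeierstrassFactorization P U) {u : C} (hu : ‖u‖ < 1)
    (h : Polynomial.aeval u P = 0) : evalHom hu (derivative O g) =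
      Polynomial.aeval u (Polynomial.derivative P) * evalHom hu U := by
  rw [H.eq_mul, Derivation.leibniz, smul_eq_mul, smul_eq_mul, map_add, map_mul, map_mul,
    evalHom_coe, h, zero_mul, zero_add, derivative_coe, evalHom_coe, mul_comm]

end Weierstrass

/-- Eisenstein's criterion: `U` is a unit, so `P.coeff 0` is a uniformizer like the constant
coefficient of `g`. -/
theorem irreducible_of_constantCoeff {O : Type*} [CommRing O] [IsDomain O]
    [IsDiscreteValuationRing O] {g U : O⟦X⟧}
    {P : Polynomial O} (H : g.IsWeierstrassFactorization P U)
    (hg : Irreducible (constantCoeff g)) (hdeg : 0 < P.natDegree) : Irreducible P := by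
  refine Polynomial.IsEisensteinAt.irreducible (𝓟 := maximalIdeal O)
    ⟨?_, H.isDistinguishedAt.mem, ?_⟩
    inferInstance H.isDistinguishedAt.monic.isPrimitive hdeg
  · rw [H.isDistinguishedAt.monic.leadingCoeff]
    exact fun h => (mem_maximalIdeal _).1 h isUnit_one
  · rw [hg.maximalIdeal_eq, Ideal.span_singleton_pow, Ideal.mem_span_singleton]
    intro hd
    have h1 : constantCoeff g ∣ 1 := by
      have h2 : constantCoeff g = P.coeff 0 * constantCoeff U := by
        conv_lhs => rw [H.eq_mul]
        rw [map_mul, ← coeff_zero_eq_constantCoeff_apply, Polynomial.coeff_coe]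
      have h3 : constantCoeff g ^ 2 ∣ constantCoeff g * 1 := by
        rw [mul_one]
        nth_rewrite 2 [h2]
        exact hd.mul_right _
      rw [pow_two] at h3
      exact (mul_dvd_mul_iff_left hg.ne_zero).1 h3
    exact hg.not_isUnit (isUnit_of_dvd_one h1)

section EvalAt

variable {O C : Type*} [CommRing O] [IsLocalRing O] [NormedField C] [Algebra O C] [IsBounded O C]
  [CompleteSpace C]

theorem evalAt_sub (f g : O⟦X⟧) {u : C} (hu : ‖u‖ < 1) :
    evalAt (f - g) u = evalAt f u - evalAt g u := map_sub (evalHom hu) f g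

variable [IsUltrametricDist C]

theorem norm_evalAt_lt_one {f : O⟦X⟧} (hf : constantCoeff f = 0) {u : C} (hu : ‖u‖ < 1) :
    ‖evalAt f u‖ < 1 := norm_evalHom_lt_one hu hf

theorem evalAt_comp (f : O⟦X⟧) {g : O⟦X⟧} (hg : constantCoeff g = 0) {u : C} (hu : ‖u‖ < 1) :
    evalAt (comp f g) u = evalAt f (evalAt g u) := evalHom_comp hu f hg

end EvalAt

/-- The points `u` of the open unit disk such that the `n`-fold iterate of `f` vanishes at `u` but
the `(n - 1)`-fold iterate does not. -/
def torsionLevel {O C : Type*} [CommRing O] [NormedField C] [Algebra O C] (f : O⟦X⟧) (n : ℕ) :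
    Set C := {u | ‖u‖ < 1 ∧ evalAt (iter f n) u = 0 ∧ evalAt (iter f (n - 1)) u ≠ 0}

/-- The monic irreducible polynomial `L` has the points of exact level `n` as roots. -/
structure IsLevelPoly {O : Type*} [CommRing O] (C : Type*) [NormedField C] [Algebra O C]
    (f : O⟦X⟧) (n : ℕ) (L : Polynomial O) : Prop where
  monic : L.Monic
  irreducible : Irreducible L
  le_natDegree : n ≤ L.natDegree
  aeval_eq_zero_iff : ∀ u : C, Polynomial.aeval u L = 0 ↔ u ∈ torsionLevel (O := O) f n

/-! ### Torsion levels and the zeros of iterates -/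

section TorsionLevel

variable {O C : Type*} [CommRing O] [NormedField C] [Algebra O C]

theorem exists_mem_torsionLevel [IsAlgClosed C] {f : O⟦X⟧} {n : ℕ} {L : Polynomial O}
    (hL : IsLevelPoly C f n L) : ∃ u : C, u ∈ torsionLevel (O := O) f n := by
  have hdeg : (L.map (algebraMap O C)).degree ≠ 0 := by
    rw [hL.monic.degree_map]
    intro h
    have h1 := Polynomial.eq_one_of_monic_natDegree_zero hL.monic
      (Polynomial.natDegree_eq_of_degree_eq_some h)
    exact hL.irreducible.not_isUnit (h1 ▸ isUnit_one)
  obtain ⟨u, hu⟩ := IsAlgClosed.exists_root _ hdeg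
  rw [Polynomial.IsRoot.def, Polynomial.eval_map_algebraMap] at hu
  exact ⟨u, (hL.aeval_eq_zero_iff u).1 hu⟩

theorem eq_zero_or_mem_torsionLevel {f : O⟦X⟧} {k : ℕ} {u : C} (hu : ‖u‖ < 1)
    (h : evalAt (iter f k) u = 0) :
    u = 0 ∨ ∃ n, n + 1 ≤ k ∧ u ∈ torsionLevel (O := O) f (n + 1) := by
  induction k with
  | zero =>
    rw [iter, evalAt_X] at h
    exact Or.inl h
  | succ k ih =>
    by_cases h0 : evalAt (iter f k) u = 0
    · rcases ih h0 with h1 | ⟨n, hn, h1⟩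
      · exact Or.inl h1
      · exact Or.inr ⟨n, by omega, h1⟩
    · exact Or.inr ⟨k, le_rfl, hu, h, h0⟩

variable [IsLocalRing O] [IsBounded O C] [CompleteSpace C] [IsUltrametricDist C]

theorem evalAt_iter_add {f : O⟦X⟧} (hf : constantCoeff f = 0) (m n : ℕ) {u : C} (hu : ‖u‖ < 1) :
    evalAt (iter f (m + n)) u = evalAt (iter f m) (evalAt (iter f n) u) := by
  induction m with
  | zero => rw [zero_add, iter, evalAt_X]
  | succ m ih =>
    have hv := norm_evalAt_lt_one (constantCoeff_iter hf n) hu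
    rw [Nat.add_right_comm, iter, iter, evalAt_comp f (constantCoeff_iter hf _) hu, ih,
      evalAt_comp f (constantCoeff_iter hf _) hv]

theorem evalAt_iter_eq_zero_of_le {f : O⟦X⟧} (hf : constantCoeff f = 0) {m n : ℕ} (hmn : m ≤ n)
    {u : C} (hu : ‖u‖ < 1) (h : evalAt (iter f m) u = 0) : evalAt (iter f n) u = 0 := by
  obtain ⟨k, rfl⟩ := Nat.exists_eq_add_of_le' hmn
  rw [evalAt_iter_add hf k m hu, h, evalAt_zero, constantCoeff_iter hf, map_zero]

theorem evalAt_mem_torsionLevel {f : O⟦X⟧} (hf : constantCoeff f = 0) {n : ℕ} {u : C}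
    (hu : u ∈ torsionLevel (O := O) f (n + 2)) : evalAt f u ∈ torsionLevel (O := O) f (n + 1) := by
  obtain ⟨h1, h2, h3⟩ := hu
  refine ⟨norm_evalAt_lt_one hf h1, ?_, ?_⟩
  · rwa [← evalAt_comp _ hf h1, ← iter_succ' hf]
  · rw [← evalAt_comp _ hf h1, ← iter_succ' hf]
    exact h3

theorem iter_eq_zero_iff_of_mem_torsionLevel {f : O⟦X⟧} (hf : constantCoeff f = 0) {n j : ℕ}
    {u : C} (hu : u ∈ torsionLevel (O := O) f (n + 1)) :
    evalAt (iter f j) u = 0 ↔ n + 1 ≤ j := by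
  refine ⟨fun h => ?_, fun h => evalAt_iter_eq_zero_of_le hf h hu.1 hu.2.1⟩
  by_contra! hlt
  exact hu.2.2 (evalAt_iter_eq_zero_of_le hf (by omega) hu.1 h)

end TorsionLevel

section Order

theorem order_map_iter {O : Type*} [CommRing O] [IsLocalRing O] {f : O⟦X⟧}
    (hf : constantCoeff f = 0) {q : ℕ} (hq : (map (residue O) f).order = q) (n : ℕ) :
    (map (residue O) (iter f n)).order = (q ^ n : ℕ) := by
  induction n with
  | zero => simp [iter]
  | succ n ih =>
    have h0 : constantCoeff (map (residue O) (iter f n)) = 0 := by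
      rw [← coeff_zero_eq_constantCoeff_apply, coeff_map, coeff_zero_eq_constantCoeff_apply,
        constantCoeff_iter hf, map_zero]
    rw [iter, map_comp _ _ (constantCoeff_iter hf n), order_comp h0 hq, ih, pow_succ']
    norm_cast

end Order

section SingleSeries

variable {O C : Type*} [CommRing O] [IsDomain O] [IsDiscreteValuationRing O]
  [IsAdicComplete (maximalIdeal O) O] [NormedField C] [Algebra O C] [FaithfulSMul O C]
  [IsBounded O C] [CompleteSpace C] [IsUltrametricDist C]

/-- With `f = X * g`, the factor `Q` is `g` composed with iterate `n`. At a zero of iterate `n` it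
takes the value `constantCoeff g = coeff 1 f ≠ 0`, so its zeros are new. The crude degree bound
serves only to make the degrees unbounded in `n`. -/
theorem exists_iter_succ_factor {f : O⟦X⟧} (hf : constantCoeff f = 0)
    (hϖ : Irreducible (coeff 1 f)) {q : ℕ} (h2 : 2 ≤ q)
    (hq : (map (residue O) f).order = q) (n : ℕ) :
    ∃ (Q U : O⟦X⟧) (L : Polynomial O), iter f (n + 1) = iter f n * Q ∧
      Q.IsWeierstrassFactorization L U ∧ Irreducible L ∧ n < L.natDegree ∧
      ∀ (u : C) (hu : ‖u‖ < 1), evalAt (iter f n) u = 0 → evalHom hu Q ≠ 0 := by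
  obtain ⟨g, hg⟩ := X_dvd_iff.2 hf
  have hg0 : constantCoeff g = coeff 1 f := by
    rw [hg, show (1 : ℕ) = 0 + 1 from rfl, coeff_succ_X_mul, coeff_zero_eq_constantCoeff_apply]
  have hi := constantCoeff_iter hf n
  have hiter : iter f (n + 1) = iter f n * comp g (iter f n) := by
    have h := comp_X_pow_mul 1 g hi
    rw [pow_one, pow_one, ← hg] at h
    exact h
  have hgo : (map (residue O) g).order = (q - 1 : ℕ) := by
    have h : (map (residue O) f).order = 1 + (map (residue O) g).order := by
      rw [hg, map_mul, map_X, order_mul, order_X]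
    rw [hq] at h
    generalize (map (residue O) g).order = r at h
    induction r using ENat.recTopCoe with
    | top => simp at h
    | coe r =>
      norm_cast at h ⊢
      omega
  have h0 : constantCoeff (map (residue O) (iter f n)) = 0 := by
    rw [← coeff_zero_eq_constantCoeff_apply, coeff_map, coeff_zero_eq_constantCoeff_apply, hi,
      map_zero]
  have hQo : (map (residue O) (comp g (iter f n))).order = ((q - 1) * q ^ n : ℕ) := by
    rw [map_comp _ _ hi, order_comp h0 hgo, order_map_iter hf hq]
    norm_cast
  have hQ0 : map (residue O) (comp g (iter f n)) ≠ 0 := by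
    rw [← order_finite_iff_ne_zero, hQo]
    exact ENat.natCast_lt_top _
  obtain ⟨L, U, H⟩ := exists_isWeierstrassFactorization hQ0
  have hdeg : n < L.natDegree := by
    rw [H.natDegree_eq_toNat_order_map, hQo, ENat.toNat_natCast]
    calc n < 2 ^ n := Nat.lt_two_pow_self
      _ ≤ q ^ n := Nat.pow_le_pow_left h2 n
      _ ≤ (q - 1) * q ^ n := Nat.le_mul_of_pos_left _ (by omega)
  have hc : constantCoeff (comp g (iter f n)) = coeff 1 f := by
    rw [constantCoeff_comp g hi, hg0]
  refine ⟨_, U, L, hiter, H, irreducible_of_constantCoeff H (by rwa [hc]) (by omega), hdeg,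
    fun u hu h => ?_⟩
  rw [evalHom_apply, evalAt_comp g hi hu, h, evalAt_zero, hg0]
  exact (map_ne_zero_iff _ (FaithfulSMul.algebraMap_injective O C)).2 hϖ.ne_zero

theorem exists_isLevelPoly {f : O⟦X⟧} (hf : constantCoeff f = 0)
    (hϖ : Irreducible (coeff 1 f)) {q : ℕ} (h2 : 2 ≤ q)
    (hq : (map (residue O) f).order = q) (n : ℕ) :
    ∃ L : Polynomial O, IsLevelPoly C f (n + 1) L := by
  obtain ⟨Q, U, L, hQ, H, hirr, hdeg, hne⟩ := exists_iter_succ_factor (C := C) hf hϖ h2 hq n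
  refine ⟨L, H.isDistinguishedAt.monic, hirr, by omega, fun u => ⟨fun h => ?_, fun h => ?_⟩⟩
  · have hu := norm_lt_one_of_aeval_eq_zero H.isDistinguishedAt h
    have hQu := (evalHom_eq_zero_iff H hu).2 h
    refine ⟨hu, ?_, fun h0 => hne u hu h0 hQu⟩
    rw [hQ, evalAt_mul _ _ hu, ← evalHom_apply hu Q, hQu, mul_zero]
  · obtain ⟨hu, h1, h3⟩ := h
    rw [hQ, evalAt_mul _ _ hu] at h1
    exact (evalHom_eq_zero_iff H hu).1 ((mul_eq_zero.1 h1).resolve_left h3)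

variable [CharZero O]

/-- The zeros of the iterates of `f` are simple. -/
theorem evalHom_derivative_iter_ne_zero {f : O⟦X⟧} (hf : constantCoeff f = 0)
    (hϖ : Irreducible (coeff 1 f)) {q : ℕ} (h2 : 2 ≤ q)
    (hq : (map (residue O) f).order = q) (n : ℕ) {u : C} (hu : ‖u‖ < 1)
    (h : evalAt (iter f n) u = 0) : evalHom hu (derivative O (iter f n)) ≠ 0 := by
  induction n with
  | zero => simp [iter]
  | succ n ih =>
    obtain ⟨Q, U, L, hQ, H, hirr, hdeg, hne⟩ := exists_iter_succ_factor (C := C) hf hϖ h2 hq n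
    rw [hQ, Derivation.leibniz, smul_eq_mul, smul_eq_mul, map_add, map_mul, map_mul]
    rw [hQ, evalAt_mul _ _ hu] at h
    -- Exactly one factor vanishes at `u`: either iterate `n`, simple by induction, or `Q`, simple
    -- because `L` is irreducible in characteristic zero.
    by_cases h0 : evalAt (iter f n) u = 0
    · rw [evalHom_apply hu (iter f n), h0, zero_mul, zero_add]
      exact mul_ne_zero (hne u hu h0) (ih h0)
    · have hQu : evalHom hu Q = 0 := (mul_eq_zero.1 h).resolve_left h0
      have hL := (evalHom_eq_zero_iff H hu).1 hQu
      rw [hQu, zero_mul, add_zero, evalHom_derivative_eq H hu hL]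
      exact mul_ne_zero h0 (mul_ne_zero
        (aeval_derivative_ne_zero H.isDistinguishedAt.monic hirr hL)
        (evalHom_ne_zero_of_isUnit hu H.isUnit))

/-- The zeros of the `n`-fold iterate of `f` in the open unit disk. -/
theorem exists_iter_zeros {f : O⟦X⟧} (hf : constantCoeff f = 0)
    (hϖ : Irreducible (coeff 1 f)) {q : ℕ} (h2 : 2 ≤ q)
    (hq : (map (residue O) f).order = q) (n : ℕ) :
    ∃ (D : Polynomial O) (V : O⟦X⟧), (iter f n).IsWeierstrassFactorization D V ∧
      D.natDegree = q ^ n ∧ (D.map (algebraMap O C)).roots.Nodup ∧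
      ∀ u : C, Polynomial.aeval u D = 0 ↔ ‖u‖ < 1 ∧ evalAt (iter f n) u = 0 := by
  have ho := order_map_iter hf hq n
  have h0 : map (residue O) (iter f n) ≠ 0 := by
    rw [← order_finite_iff_ne_zero, ho]
    exact ENat.natCast_lt_top _
  obtain ⟨D, V, H⟩ := exists_isWeierstrassFactorization h0
  refine ⟨D, V, H, ?_, nodup_roots_map H.isDistinguishedAt.monic.ne_zero fun u hu => ?_,
    fun u => ⟨fun h => ?_, fun h => (evalHom_eq_zero_iff H h.1).1 h.2⟩⟩
  · rw [H.natDegree_eq_toNat_order_map, ho, ENat.toNat_natCast]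
  · have hu1 := norm_lt_one_of_aeval_eq_zero H.isDistinguishedAt hu
    have h := evalHom_derivative_iter_ne_zero hf hϖ h2 hq n hu1 ((evalHom_eq_zero_iff H hu1).2 hu)
    rw [evalHom_derivative_eq H hu1 hu] at h
    exact left_ne_zero_of_mul h
  · have hu1 := norm_lt_one_of_aeval_eq_zero H.isDistinguishedAt h
    exact ⟨hu1, (evalHom_eq_zero_iff H hu1).2 h⟩

end SingleSeries

/-- A commuting family over a local ring such that the series attached to the irreducible element
`ϖ` has Weierstrass degree `q ≥ 2`. -/
structure IsFullFamily {O : Type*} [CommRing O] [IsLocalRing O] (ϖ : O) (F : O → O⟦X⟧) (q : ℕ) :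
    Prop extends IsCommutingFamily F where
  irreducible : Irreducible ϖ
  two_le : 2 ≤ q
  order_eq : (map (residue O) (F ϖ)).order = q

/-! ### Commuting families and their fixed points -/

namespace IsFullFamily

section Algebraic

variable {O : Type*} [CommRing O] [IsLocalRing O] {ϖ : O} {F : O → O⟦X⟧} {q : ℕ}

theorem irreducible_coeff_one (hF : IsFullFamily ϖ F q) : Irreducible (coeff 1 (F ϖ)) := by
  rw [hF.coeff_one_eq]
  exact hF.irreducible

theorem coeff_one_iter (hF : IsFullFamily ϖ F q) (n : ℕ) : coeff 1 (iter (F ϖ) n) = ϖ ^ n := by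
  induction n with
  | zero => rw [iter, coeff_one_X, pow_zero]
  | succ n ih =>
    have h0 := hF.constantCoeff_eq_zero ϖ
    rw [iter, coeff_one_comp h0 (constantCoeff_iter h0 n), ih, hF.coeff_one_eq, pow_succ']

variable [IsDomain O]

theorem eq_of_comm {g h : O⟦X⟧} (hF : IsFullFamily ϖ F q)
    (hg : constantCoeff g = 0) (hh : constantCoeff h = 0)
    (hfg : comp (F ϖ) g = comp g (F ϖ)) (hfh : comp (F ϖ) h = comp h (F ϖ))
    (h1 : coeff 1 g = coeff 1 h) : g = h := by
  refine eq_of_comp_comm (hF.constantCoeff_eq_zero ϖ) (fun n hn h => ?_) hg hh hfg hfh h1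
  rw [hF.coeff_one_eq] at h
  obtain ⟨m, rfl⟩ := Nat.exists_eq_add_of_le hn
  have h2 : ϖ * ϖ ^ (m + 1) = ϖ * 1 := by linear_combination h
  have h3 := mul_left_cancel₀ hF.irreducible.ne_zero h2
  rw [pow_succ'] at h3
  exact hF.irreducible.not_isUnit (IsUnit.of_mul_eq_one _ h3)

theorem apply_one (hF : IsFullFamily ϖ F q) : F 1 = X :=
  hF.eq_of_comm (hF.constantCoeff_eq_zero 1) constantCoeff_X (hF.comm _ _)
    (by rw [comp_X_right, comp_X_left (hF.constantCoeff_eq_zero ϖ)])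
    (by rw [hF.coeff_one_eq, coeff_one_X])

theorem comp_eq (hF : IsFullFamily ϖ F q) (α β : O) : comp (F α) (F β) = F (α * β) := by
  have h0 := hF.constantCoeff_eq_zero
  refine hF.eq_of_comm (by rw [constantCoeff_comp _ (h0 β), h0]) (h0 _) ?_ (hF.comm _ _) ?_
  · rw [← comp_assoc _ (h0 α) (h0 β), hF.comm ϖ α, comp_assoc _ (h0 ϖ) (h0 β), hF.comm ϖ β,
      comp_assoc _ (h0 β) (h0 ϖ)]
  · rw [coeff_one_comp (h0 α) (h0 β), hF.coeff_one_eq, hF.coeff_one_eq, hF.coeff_one_eq]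

end Algebraic

theorem exists_linear_factor {O : Type*} [CommRing O] {h : O⟦X⟧} (h0 : constantCoeff h = 0) :
    ∃ g, h = X * (PowerSeries.C (coeff 1 h) + X * g) := by
  obtain ⟨g, hg⟩ := X_dvd_iff.2 h0
  obtain ⟨k, hk⟩ := X_dvd_iff.2
    (show constantCoeff (g - PowerSeries.C (constantCoeff g)) = 0 by simp)
  have h1 : coeff 1 h = constantCoeff g := by
    rw [hg, show (1 : ℕ) = 0 + 1 from rfl, coeff_succ_X_mul, coeff_zero_eq_constantCoeff_apply]
  exact ⟨k, by rw [h1, ← hk, add_sub_cancel, hg]⟩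

section Evaluation

variable {O C : Type*} [CommRing O] [IsLocalRing O] [NormedField C] [Algebra O C]
  [IsBounded O C] [CompleteSpace C] [IsUltrametricDist C] {ϖ : O} {F : O → O⟦X⟧} {q : ℕ}

theorem exists_evalAt_eq {h : O⟦X⟧} (h0 : constantCoeff h = 0) {u : C} (hu : ‖u‖ < 1) :
    ∃ y : C, ‖y‖ ≤ 1 ∧ evalAt h u = u * (algebraMap O C (coeff 1 h) + u * y) := by
  obtain ⟨g, hg⟩ := exists_linear_factor h0
  refine ⟨evalHom hu g, norm_evalHom_le_one hu g, ?_⟩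
  rw [← evalHom_apply hu]
  conv_lhs => rw [hg]
  rw [map_mul, map_add, map_mul, evalHom_X, evalHom_C]

theorem norm_lt_one (hF : IsFullFamily ϖ F q) (α : O) {u : C} (hu : ‖u‖ < 1) :
    ‖evalAt (F α) u‖ < 1 := norm_evalAt_lt_one (hF.constantCoeff_eq_zero α) hu

theorem evalAt_iter_comm (hF : IsFullFamily ϖ F q) (α : O) (n : ℕ) {u : C} (hu : ‖u‖ < 1) :
    evalAt (iter (F ϖ) n) (evalAt (F α) u) = evalAt (F α) (evalAt (iter (F ϖ) n) u) := by
  have h0 := hF.constantCoeff_eq_zero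
  rw [← evalAt_comp _ (h0 α) hu, ← evalAt_comp _ (constantCoeff_iter (h0 ϖ) n) hu,
    comp_iter_comm (h0 ϖ) (h0 α) (hF.comm α ϖ) n]

/-- The iterates of a point of the open unit disk under `F ϖ` tend to zero. -/
theorem norm_evalAt_iter_le (hF : IsFullFamily ϖ F q) {u : C} (hu : ‖u‖ < 1) (n : ℕ) :
    ‖evalAt (iter (F ϖ) n) u‖ ≤ (max ‖algebraMap O C ϖ‖ ‖u‖) ^ n := by
  have h0 := hF.constantCoeff_eq_zero ϖ
  have hr : max ‖algebraMap O C ϖ‖ ‖u‖ ≤ 1 := max_le (IsBounded.norm_le_one _) hu.le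
  induction n with
  | zero => simpa [iter, evalAt_X] using hu.le
  | succ n ih =>
    have hi := constantCoeff_iter h0 n
    have hv := norm_evalAt_lt_one hi hu
    have hvu : ‖evalAt (iter (F ϖ) n) u‖ ≤ ‖u‖ := norm_evalHom_le hu hi
    rw [iter, evalAt_comp _ hi hu]
    obtain ⟨y, hy, he⟩ := exists_evalAt_eq h0 hv
    rw [he, norm_mul, pow_succ]
    refine mul_le_mul ih ?_ (norm_nonneg _) (by positivity)
    refine (IsUltrametricDist.norm_add_le_max _ _).trans (max_le_max ?_ ?_)
    · rw [hF.coeff_one_eq]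
    · rw [norm_mul]
      exact (mul_le_of_le_one_right (norm_nonneg _) hy).trans hvu

variable [IsDomain O]

theorem evalAt_evalAt (hF : IsFullFamily ϖ F q) (α β : O) {u : C} (hu : ‖u‖ < 1) :
    evalAt (F α) (evalAt (F β) u) = evalAt (F (α * β)) u := by
  rw [← evalAt_comp _ (hF.constantCoeff_eq_zero β) hu, hF.comp_eq]

theorem evalAt_eq_iff_mul_inv (hF : IsFullFamily ϖ F q) (α : Oˣ) (β : O) {u : C} (hu : ‖u‖ < 1) :
    evalAt (F α) u = evalAt (F β) u ↔ evalAt (F (↑α⁻¹ * β)) u = u := by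
  rw [← hF.evalAt_evalAt _ _ hu]
  constructor
  · intro h
    rw [← h, hF.evalAt_evalAt _ _ hu, Units.inv_mul, hF.apply_one, evalAt_X]
  · intro h
    have h1 := congrArg (evalAt (F α)) h
    rwa [hF.evalAt_evalAt _ _ (hF.norm_lt_one β hu), Units.mul_inv, hF.apply_one, evalAt_X,
      eq_comm] at h1

end Evaluation

section Dynamics

variable {O C : Type*} [CommRing O] [IsDomain O] [IsDiscreteValuationRing O] [NormedField C]
  [Algebra O C] [FaithfulSMul O C] [IsBounded O C] [CompleteSpace C] [IsUltrametricDist C]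
  {ϖ : O} {F : O → O⟦X⟧} {q : ℕ}

/-- The fixed points of the nontrivial members of the family are torsion. -/
theorem exists_iter_eq_zero_of_fixed (hF : IsFullFamily ϖ F q) {α : O} (hα : α ≠ 1) {u : C}
    (hu : ‖u‖ < 1) (h : evalAt (F α) u = u) : ∃ k, evalAt (iter (F ϖ) k) u = 0 := by
  have h0 := hF.constantCoeff_eq_zero
  have hr : max ‖algebraMap O C ϖ‖ ‖u‖ < 1 :=
    max_lt (IsBounded.norm_lt_one _ ((mem_maximalIdeal _).2 hF.irreducible.not_isUnit)) hu
  have hc : 0 < ‖algebraMap O C (α - 1)‖ := by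
    rw [norm_pos_iff]
    exact (map_ne_zero_iff _ (FaithfulSMul.algebraMap_injective O C)).2 (sub_ne_zero.2 hα)
  obtain ⟨k, hk⟩ := exists_pow_lt_of_lt_one hc hr
  refine ⟨k, ?_⟩
  have hv1 := (hF.norm_evalAt_iter_le hu k).trans_lt hk
  have hv2 := norm_evalAt_lt_one (constantCoeff_iter (h0 ϖ) k) hu
  have hfix := hF.evalAt_iter_comm α k hu
  rw [h] at hfix
  set v := evalAt (iter (F ϖ) k) u
  have hX : constantCoeff (F α - X) = 0 := by rw [map_sub, h0, constantCoeff_X, sub_zero]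
  obtain ⟨y, hy, he⟩ := exists_evalAt_eq hX hv2
  rw [evalAt_sub _ _ hv2, ← hfix, evalAt_X, sub_self, map_sub, hF.coeff_one_eq, coeff_one_X] at he
  -- Here `0 = v * ((α - 1) + v * y)` with `‖v‖ < ‖α - 1‖` and `‖y‖ ≤ 1`, so the second factor
  -- cannot vanish.
  refine (mul_eq_zero.1 he.symm).resolve_right fun h2 => ?_
  rw [eq_neg_of_add_eq_zero_left h2, norm_neg, norm_mul] at hv1
  exact absurd hv1 (not_lt.2 (mul_le_of_le_one_right (norm_nonneg _) hy))

variable [CharZero O] [IsAdicComplete (maximalIdeal O) O]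

/-- Differentiate the commutation of `F α` with iterate `k` at `u`, and cancel the derivative of the
iterate, nonzero because its zeros are simple. -/
theorem evalHom_derivative_of_fixed (hF : IsFullFamily ϖ F q) (α : O) {u : C}
    (hu : ‖u‖ < 1) (h : evalAt (F α) u = u) {k : ℕ} (hk : evalAt (iter (F ϖ) k) u = 0) :
    evalHom hu (derivative O (F α)) = algebraMap O C α := by
  have h0 := hF.constantCoeff_eq_zero
  have hi := constantCoeff_iter (h0 ϖ) k
  have h1 := congrArg (fun g => evalAt (derivative O g) u)
    (comp_iter_comm (h0 ϖ) (h0 α) (hF.comm α ϖ) k)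
  rw [derivative_comp _ hi, derivative_comp _ (h0 α), evalAt_mul _ _ hu, evalAt_mul _ _ hu,
    evalAt_comp _ hi hu, evalAt_comp _ (h0 α) hu, h, hk, evalAt_zero, constantCoeff_derivative,
    hF.coeff_one_eq, mul_comm] at h1
  exact (mul_left_cancel₀ (evalHom_derivative_iter_ne_zero (h0 ϖ) hF.irreducible_coeff_one
    hF.two_le hF.order_eq k hu hk) h1).symm

/-- Otherwise `(F ϖ)'`, whose constant coefficient `ϖ` is not a unit, has a zero `z` in the disk,
and only finitely many. By the chain rule unit members of the family permute these zeros, so two of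
them agree at `z`; then a nontrivial member fixes `z`, which is therefore torsion. This contradicts
the simplicity of the zeros of the iterates. -/
theorem map_residue_derivative_eq_zero (C : Type*) [NormedField C] [Algebra O C] [FaithfulSMul O C]
    [IsBounded O C] [CompleteSpace C] [IsUltrametricDist C] [IsAlgClosed C]
    (hF : IsFullFamily ϖ F q) :
    map (residue O) (derivative O (F ϖ)) = 0 := by
  by_contra hne
  have h0 := hF.constantCoeff_eq_zero
  have hc : constantCoeff (derivative O (F ϖ)) = ϖ := by
    rw [constantCoeff_derivative, hF.coeff_one_eq]
  obtain ⟨P, U, H⟩ := exists_isWeierstrassFactorization hne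
  have hP0 : (P.map (algebraMap O C)) ≠ 0 := (H.isDistinguishedAt.monic.map _).ne_zero
  have hdeg : (P.map (algebraMap O C)).degree ≠ 0 := by
    rw [H.isDistinguishedAt.monic.degree_map]
    intro h
    have h1 := Polynomial.eq_one_of_monic_natDegree_zero H.isDistinguishedAt.monic
      (Polynomial.natDegree_eq_of_degree_eq_some h)
    have h2 := H.eq_mul
    rw [h1, Polynomial.coe_one, one_mul] at h2
    have h3 := H.isUnit
    rw [← h2, isUnit_iff_constantCoeff, hc] at h3
    exact hF.irreducible.not_isUnit h3
  obtain ⟨z, hz⟩ := IsAlgClosed.exists_root _ hdeg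
  rw [Polynomial.IsRoot.def, Polynomial.eval_map_algebraMap] at hz
  have hz1 := norm_lt_one_of_aeval_eq_zero H.isDistinguishedAt hz
  have hfz : evalAt (derivative O (F ϖ)) z = 0 := (evalHom_eq_zero_iff H hz1).2 hz
  -- An infinite supply of distinct units, for the pigeonhole argument.
  have hunit (i : ℕ) : IsUnit (1 + ϖ ^ (i + 1)) := by
    by_contra h
    have h1 : ϖ ^ (i + 1) ∈ maximalIdeal O :=
      Ideal.pow_mem_of_mem _ ((mem_maximalIdeal _).2 hF.irreducible.not_isUnit) _ (by omega)
    have h2 := (maximalIdeal O).sub_mem ((mem_maximalIdeal _).2 h) h1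
    rw [add_sub_cancel_right] at h2
    exact (mem_maximalIdeal _).1 h2 isUnit_one
  have hroot (i : ℕ) : evalAt (F (hunit i).unit) z ∈ {u : C | Polynomial.aeval u P = 0} := by
    have hv := hF.norm_lt_one ((hunit i).unit : O) hz1
    rw [Set.mem_ofPred_eq, ← evalHom_eq_zero_iff H hv, evalHom_apply]
    have h1 := congrArg (fun g => evalAt (derivative O g) z) (hF.comm ϖ (hunit i).unit)
    rw [derivative_comp _ (h0 _), derivative_comp _ (h0 ϖ), evalAt_mul _ _ hz1,
      evalAt_mul _ _ hz1, hfz, mul_zero, evalAt_comp _ (h0 _) hz1] at h1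
    refine (mul_eq_zero.1 h1).resolve_right (evalHom_ne_zero_of_isUnit hz1 ?_)
    rw [isUnit_iff_constantCoeff, constantCoeff_derivative, hF.coeff_one_eq]
    exact Units.isUnit _
  have hfin : {u : C | Polynomial.aeval u P = 0}.Finite := by
    refine ((P.map (algebraMap O C)).finite_setOfPred_isRoot hP0).subset fun u hu => ?_
    rw [Set.mem_ofPred_eq, Polynomial.IsRoot.def, Polynomial.eval_map_algebraMap]
    exact hu
  have := hfin.to_subtype
  obtain ⟨i, j, hij, he⟩ := Finite.exists_ne_map_eq_of_infinite
    fun i : ℕ => (⟨_, hroot i⟩ : {u : C | Polynomial.aeval u P = 0})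
  have he' := (hF.evalAt_eq_iff_mul_inv _ _ hz1).1 (congrArg Subtype.val he)
  have hne1 : (↑(hunit i).unit⁻¹ * ((hunit j).unit : O)) ≠ 1 := by
    intro h
    have h1 : ((hunit i).unit : O) = (hunit j).unit := Units.inv_mul_eq_one.1 h
    have h2 : ϖ ^ (i + 1) = ϖ ^ (j + 1) := add_left_cancel h1
    have h3 := pow_injective_of_not_isUnit hF.irreducible.not_isUnit hF.irreducible.ne_zero h2
    omega
  obtain ⟨k, hk⟩ := hF.exists_iter_eq_zero_of_fixed hne1 hz1 he'
  have hk' := evalAt_iter_eq_zero_of_le (h0 ϖ) (Nat.le_succ k) hz1 hk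
  refine evalHom_derivative_iter_ne_zero (h0 ϖ) hF.irreducible_coeff_one hF.two_le hF.order_eq
    (k + 1) hz1 hk' ?_
  rw [iter_succ' (h0 ϖ), derivative_comp _ (h0 ϖ), map_mul, evalHom_apply hz1 (derivative O (F ϖ)),
    hfz, mul_zero]

/-- Suppose `F α = X + ϖ ^ m * G` with `m ≥ 1` and `G` nonzero modulo `ϖ`. To first order `F ϖ ∘ F α
- F ϖ` is `ϖ ^ m * (F ϖ)' * G`, hence divisible by `ϖ ^ (m + 1)`. By commutation it equals `ϖ ^ m *
(G ∘ F ϖ)`, so `G ∘ F ϖ` vanishes modulo `ϖ`; but its reduction has finite order. -/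
theorem map_residue_sub_X_ne_zero (C : Type*) [NormedField C] [Algebra O C] [FaithfulSMul O C]
    [IsBounded O C] [CompleteSpace C] [IsUltrametricDist C] [IsAlgClosed C]
    (hF : IsFullFamily ϖ F q) {α : O} (hα : α ≠ 1) :
    map (residue O) (F α - X) ≠ 0 := by
  intro hres
  have h0 := hF.constantCoeff_eq_zero
  have hϖ := hF.irreducible
  have hfm : FiniteMultiplicity (PowerSeries.C ϖ) (F α - X) := by
    obtain ⟨N, hN⟩ := FiniteMultiplicity.of_not_isUnit hϖ.not_isUnit (sub_ne_zero.2 hα)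
    refine ⟨N, fun ⟨g, hg⟩ => hN ⟨coeff 1 g, ?_⟩⟩
    have h1 := congrArg (coeff 1) hg
    rwa [← map_pow, coeff_C_mul, map_sub, hF.coeff_one_eq, coeff_one_X] at h1
  obtain ⟨G, hG, hnd⟩ := hfm.exists_eq_pow_mul_and_not_dvd
  set m := multiplicity (PowerSeries.C ϖ) (F α - X)
  have hm : m ≠ 0 := by
    intro hm
    rw [hm, pow_zero, one_mul] at hG
    exact hnd (hG ▸ (C_dvd_iff_map_residue_eq_zero hϖ _).2 hres)
  rw [C_dvd_iff_map_residue_eq_zero hϖ] at hnd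
  rw [← map_pow] at hG
  have hder := (C_dvd_iff_map_residue_eq_zero hϖ _).2 (hF.map_residue_derivative_eq_zero C)
  have hcong (k : ℕ) : ϖ ^ (m + 1) ∣ coeff k (comp (F ϖ) (F α) - comp (F ϖ) X) := by
    rw [coeff_comp_sub_comp _ (h0 α) constantCoeff_X]
    refine finsum_induction (p := fun x => ϖ ^ (m + 1) ∣ x) (dvd_zero _)
      (fun x y hx hy => dvd_add hx hy) fun i => ?_
    obtain ⟨r, hr⟩ := Polynomial.powAddExpansion (X : O⟦X⟧) (PowerSeries.C (ϖ ^ m) * G) i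
    have hFα : F α = X + PowerSeries.C (ϖ ^ m) * G := by rw [← hG, add_sub_cancel]
    have hi : ϖ ∣ coeff i (F ϖ) * i := by
      rcases Nat.eq_zero_or_pos i with rfl | hi
      · simp
      · obtain ⟨j, rfl⟩ := Nat.exists_eq_add_of_lt hi
        obtain ⟨g, hg⟩ := hder
        have h1 := congrArg (coeff j) hg
        rw [coeff_derivative, coeff_C_mul] at h1
        exact ⟨_, by rw [← h1]; simp [add_comm]⟩
    obtain ⟨c, hc⟩ := hi
    have hexp : F α ^ i - X ^ i =
        PowerSeries.C (ϖ ^ m) * ((i : O⟦X⟧) * (X ^ (i - 1) * G)) +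
          PowerSeries.C (ϖ ^ (2 * m)) * (r * G ^ 2) := by
      rw [hFα, hr, pow_mul', map_pow _ _ 2]
      ring
    have hnat : (i : O⟦X⟧) = PowerSeries.C (i : O) := (map_natCast _ i).symm
    rw [hexp, map_add, hnat, coeff_C_mul, coeff_C_mul, coeff_C_mul, mul_add]
    refine dvd_add ⟨c * coeff k (X ^ (i - 1) * G), ?_⟩ ?_
    -- The linear term gains a factor `ϖ` from the derivative; the quadratic one has `2 * m ≥ m +
    -- 1`, as `m ≠ 0`.
    · rw [pow_succ]
      linear_combination (ϖ ^ m * coeff k (X ^ (i - 1) * G)) * hc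
    · exact Dvd.dvd.mul_left (Dvd.dvd.mul_right (pow_dvd_pow ϖ (by omega)) _) _
  have hcomm : comp (F ϖ) (F α) - comp (F ϖ) X = PowerSeries.C (ϖ ^ m) * comp G (F ϖ) := by
    rw [hF.comm, comp_X_right]
    have h1 : F α = X + PowerSeries.C (ϖ ^ m) * G := by rw [← hG, add_sub_cancel]
    conv_lhs => rw [h1]
    rw [comp_add _ _ (h0 ϖ), comp_X_left (h0 ϖ), comp_mul _ _ (h0 ϖ), comp_C, add_sub_cancel_left]
  have hGf : map (residue O) (comp G (F ϖ)) = 0 := by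
    rw [← C_dvd_iff_map_residue_eq_zero hϖ]
    choose g hg using hcong
    refine ⟨PowerSeries.mk g, ?_⟩
    ext k
    have h1 := hg k
    rw [hcomm, coeff_C_mul, pow_succ, mul_assoc] at h1
    rw [coeff_C_mul, coeff_mk]
    exact mul_left_cancel₀ (pow_ne_zero m hϖ.ne_zero) h1
  have hfin := order_finite_iff_ne_zero.2 hnd
  obtain ⟨a, ha⟩ := ENat.ne_top_iff_exists.1 hfin.ne
  have hf0 : constantCoeff (map (residue O) (F ϖ)) = 0 := by
    rw [← coeff_zero_eq_constantCoeff_apply, coeff_map, coeff_zero_eq_constantCoeff_apply, h0,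
      map_zero]
  rw [map_comp _ _ (h0 ϖ)] at hGf
  have ho := order_comp hf0 ha.symm
  rw [hGf, order_zero, hF.order_eq, ← Nat.cast_mul] at ho
  exact ENat.top_ne_natCast _ ho

end Dynamics
end IsFullFamily

theorem dvd_of_not_isUnit {O : Type*} [CommRing O] [IsDomain O] [IsDiscreteValuationRing O]
    {ϖ α : O} (hϖ : Irreducible ϖ) (hα : ¬ IsUnit α) : ϖ ∣ α := by
  rwa [← mem_nonunits_iff, ← mem_maximalIdeal, hϖ.maximalIdeal_eq, Ideal.mem_span_singleton] at hα

namespace IsFullFamily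

variable {O C : Type*} [CommRing O] [IsDomain O] [IsDiscreteValuationRing O] [CharZero O]
  [IsAdicComplete (maximalIdeal O) O] [NormedField C] [Algebra O C] [FaithfulSMul O C]
  [IsBounded O C] [CompleteSpace C] [IsUltrametricDist C] [IsAlgClosed C]
  {ϖ : O} {F : O → O⟦X⟧} {q : ℕ}

/-- If the nontrivial member `F α` fixes a point of exact level `n + 1`, it fixes all points of
level at most `n + 1`; its fixed points are the zeros of some iterate of `F ϖ`. -/
theorem exists_fixed_iff_iter_eq_zero (C : Type*) [NormedField C] [Algebra O C] [FaithfulSMul O C]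
    [IsBounded O C] [CompleteSpace C] [IsUltrametricDist C] [IsAlgClosed C]
    (hF : IsFullFamily ϖ F q) {α : O} (hα : α ≠ 1) :
    ∃ j, ∀ u : C, ‖u‖ < 1 → (evalAt (F α) u = u ↔ evalAt (iter (F ϖ) j) u = 0) := by
  classical
  have h0 := hF.constantCoeff_eq_zero
  obtain ⟨P, U, H⟩ := exists_isWeierstrassFactorization (hF.map_residue_sub_X_ne_zero C hα)
  have hPz {u : C} (hu : ‖u‖ < 1) : Polynomial.aeval u P = 0 ↔ evalAt (F α) u = u := by
    rw [← evalHom_eq_zero_iff H hu, evalHom_apply, evalAt_sub _ _ hu, evalAt_X, sub_eq_zero]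
  choose L hL using fun n => exists_isLevelPoly (C := C) (h0 ϖ) hF.irreducible_coeff_one hF.two_le
    hF.order_eq n
  -- By irreducibility of `L n`, one fixed point of level `n + 1` makes the whole level fixed.
  have hfix (n : ℕ) {u : C} (hu : u ∈ torsionLevel (O := O) (F ϖ) (n + 1)) :
      L n ∣ P ↔ evalAt (F α) u = u := by
    have hu0 := ((hL n).aeval_eq_zero_iff u).2 hu
    rw [← hPz hu.1]
    refine ⟨fun hd => ?_, dvd_of_aeval_eq_zero (hL n).monic (hL n).irreducible hu0⟩
    obtain ⟨R, hR⟩ := hd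
    rw [hR, map_mul, hu0, zero_mul]
  have hdown (n : ℕ) (h : L (n + 1) ∣ P) : L n ∣ P := by
    obtain ⟨u, hu⟩ := exists_mem_torsionLevel (hL (n + 1))
    have h1 := (hfix (n + 1) hu).1 h
    refine (hfix n (evalAt_mem_torsionLevel (h0 ϖ) hu)).2 ?_
    rw [hF.evalAt_evalAt _ _ hu.1, mul_comm, ← hF.evalAt_evalAt _ _ hu.1, h1]
  -- `L n` has degree at least `n + 1`, which exceeds that of `P` for `n = P.natDegree`.
  have hex : ∃ n, ¬ L n ∣ P := by
    refine ⟨P.natDegree, fun h => ?_⟩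
    have h1 := Polynomial.natDegree_le_of_dvd h H.isDistinguishedAt.monic.ne_zero
    have h2 := (hL P.natDegree).le_natDegree
    omega
  have hlt (n : ℕ) : L n ∣ P ↔ n < Nat.find hex := by
    refine ⟨fun h => ?_, fun h => not_not.1 (Nat.find_min hex h)⟩
    by_contra! hle
    refine Nat.find_spec hex ?_
    exact Nat.decreasingInduction' (P := fun k => L k ∣ P) (fun k _ _ hk => hdown k hk) hle h
  refine ⟨Nat.find hex, fun u hu => ⟨fun h => ?_, fun h => ?_⟩⟩
  · obtain ⟨k, hk⟩ := hF.exists_iter_eq_zero_of_fixed hα hu h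
    rcases eq_zero_or_mem_torsionLevel hu hk with rfl | ⟨n, -, hn⟩
    · rw [evalAt_zero, constantCoeff_iter (h0 ϖ), map_zero]
    · exact evalAt_iter_eq_zero_of_le (h0 ϖ) ((hlt n).1 ((hfix n hn).2 h)) hu hn.2.1
  · rcases eq_zero_or_mem_torsionLevel hu h with rfl | ⟨n, hle, hn⟩
    · rw [evalAt_zero, h0, map_zero]
    · exact (hfix n hn).1 ((hlt n).2 hle)

/-- The fixed points of `F α` are the zeros of the `j`-fold iterate of `F ϖ`, where `α - 1` is
associated to `ϖ ^ j`, and `F α - T` has Weierstrass degree `q ^ j`. -/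
theorem exists_fixed_structure (C : Type*) [NormedField C] [Algebra O C] [FaithfulSMul O C]
    [IsBounded O C] [CompleteSpace C] [IsUltrametricDist C] [IsAlgClosed C]
    (hF : IsFullFamily ϖ F q) {α : O} (hα : α ≠ 1) :
    ∃ j, (map (residue O) (F α - X)).order = (q ^ j : ℕ) ∧ Associated (α - 1) (ϖ ^ j) ∧
      ∀ u : C, ‖u‖ < 1 → (evalAt (F α) u = u ↔ evalAt (iter (F ϖ) j) u = 0) := by
  have h0 := hF.constantCoeff_eq_zero
  obtain ⟨j, hj⟩ := hF.exists_fixed_iff_iter_eq_zero C hα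
  have hne := hF.map_residue_sub_X_ne_zero C hα
  obtain ⟨P, U, H⟩ := exists_isWeierstrassFactorization hne
  have hPz {u : C} (hu : ‖u‖ < 1) : Polynomial.aeval u P = 0 ↔ evalAt (F α) u = u := by
    rw [← evalHom_eq_zero_iff H hu, evalHom_apply, evalAt_sub _ _ hu, evalAt_X, sub_eq_zero]
  obtain ⟨D, V, HD, hdeg, hnodup, hDz⟩ := exists_iter_zeros (C := C) (h0 ϖ)
    hF.irreducible_coeff_one hF.two_le hF.order_eq j
  have hPD : P = D := by
    refine eq_of_nodup_roots H.isDistinguishedAt.monic HD.isDistinguishedAt.monic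
      (nodup_roots_map H.isDistinguishedAt.monic.ne_zero fun u hu => ?_) hnodup fun u => ?_
    · have hu1 := norm_lt_one_of_aeval_eq_zero H.isDistinguishedAt hu
      have hfix := (hPz hu1).1 hu
      -- The derivative of `F α - X` at a fixed point is `α - 1 ≠ 0`, so the roots of `P` are
      -- simple.
      have hd := hF.evalHom_derivative_of_fixed α hu1 hfix ((hj u hu1).1 hfix)
      have h1 := evalHom_derivative_eq H hu1 hu
      rw [map_sub, derivative_X, map_sub, hd, map_one] at h1
      refine left_ne_zero_of_mul (h1 ▸ sub_ne_zero.2 fun h => hα ?_)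
      exact FaithfulSMul.algebraMap_injective O C (h.trans (map_one _).symm)
    · rw [hDz]
      constructor
      · intro hu
        have hu1 := norm_lt_one_of_aeval_eq_zero H.isDistinguishedAt hu
        exact ⟨hu1, (hj u hu1).1 ((hPz hu1).1 hu)⟩
      · rintro ⟨hu1, hu⟩
        exact (hPz hu1).2 ((hj u hu1).2 hu)
  refine ⟨j, ?_, ?_, hj⟩
  · have h1 := H.natDegree_eq_toNat_order_map
    rw [hPD, hdeg] at h1
    rw [h1, ENat.natCast_toNat (order_finite_iff_ne_zero.2 hne).ne]
  -- `D` has no constant term, so a unit cofactor changes the linear coefficient only by a unit.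
  -- This applies both to `F α - X` and to iterate `j`.
  · have hcoeff {g W : O⟦X⟧} (hg : constantCoeff g = 0) (hW : IsUnit W)
        (h : g = (D : O⟦X⟧) * W) : Associated (coeff 1 g) (D.coeff 1) := by
      have hW0 := isUnit_iff_constantCoeff.1 hW
      have hD0 : constantCoeff (D : O⟦X⟧) = 0 := by
        rw [h, map_mul] at hg
        exact (mul_eq_zero.1 hg).resolve_right hW0.ne_zero
      obtain ⟨E, hE⟩ := X_dvd_iff.2 hD0
      have e1 : D.coeff 1 = constantCoeff E := by
        rw [← Polynomial.coeff_coe, hE, show (1 : ℕ) = 0 + 1 from rfl, coeff_succ_X_mul,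
          coeff_zero_eq_constantCoeff_apply]
      have e2 : coeff 1 g = constantCoeff E * constantCoeff W := by
        rw [h, hE, mul_assoc, show (1 : ℕ) = 0 + 1 from rfl, coeff_succ_X_mul,
          coeff_zero_eq_constantCoeff_apply, map_mul]
      rw [e1, e2]
      exact associated_mul_unit_left _ _ hW0
    have a1 := hcoeff (g := F α - X) (by rw [map_sub, h0, constantCoeff_X, sub_zero]) H.isUnit
      (hPD ▸ H.eq_mul)
    have a2 := hcoeff (constantCoeff_iter (h0 ϖ) j) HD.isUnit HD.eq_mul
    rw [hF.coeff_one_iter] at a2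
    rw [map_sub, hF.coeff_one_eq, coeff_one_X] at a1
    exact a1.trans a2.symm

theorem fixed_iff (hF : IsFullFamily ϖ F q) {n : ℕ} {u : C}
    (hu : u ∈ torsionLevel (O := O) (F ϖ) (n + 1)) (α : O) :
    evalAt (F α) u = u ↔ ϖ ^ (n + 1) ∣ α - 1 := by
  rcases eq_or_ne α 1 with rfl | hα
  · simp [hF.apply_one, evalAt_X]
  · obtain ⟨j, -, ha, hj⟩ := hF.exists_fixed_structure C hα
    rw [hj u hu.1, iter_eq_zero_iff_of_mem_torsionLevel (hF.constantCoeff_eq_zero ϖ) hu,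
      ha.dvd_iff_dvd_right, pow_dvd_pow_iff hF.irreducible.ne_zero hF.irreducible.not_isUnit]

theorem wideg_sub_X (C : Type*) [NormedField C] [Algebra O C] [FaithfulSMul O C]
    [IsBounded O C] [CompleteSpace C] [IsUltrametricDist C] [IsAlgClosed C]
    (hF : IsFullFamily ϖ F q) {α : O} {n : ℕ} (h : ϖ ^ n ∣ α - 1)
    (h' : ¬ ϖ ^ (n + 1) ∣ α - 1) : wideg (F α - X) = (q ^ n : ℕ) := by
  have hα : α ≠ 1 := by
    rintro rfl
    simp at h'
  obtain ⟨j, ho, ha, -⟩ := hF.exists_fixed_structure C hα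
  rw [ha.dvd_iff_dvd_right, pow_dvd_pow_iff hF.irreducible.ne_zero hF.irreducible.not_isUnit]
    at h h'
  rw [wideg_eq_order, ho, show j = n by omega]

theorem pow_dvd_sub_of_unit (hF : IsFullFamily ϖ F q) {n : ℕ} {u : C}
    (hu : u ∈ torsionLevel (O := O) (F ϖ) (n + 1)) {α β : O} (hα : IsUnit α)
    (h : evalAt (F α) u = evalAt (F β) u) : ϖ ^ (n + 1) ∣ α - β := by
  obtain ⟨α, rfl⟩ := hα
  have h1 := (hF.fixed_iff hu _).1 ((hF.evalAt_eq_iff_mul_inv α β hu.1).1 h)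
  have h2 := h1.mul_left (α : O)
  rw [mul_sub, Units.mul_inv_cancel_left, mul_one] at h2
  exact (dvd_sub_comm).1 h2

/-- When one of `α`, `β` is a unit, inverting it reduces to `fixed_iff`. Otherwise `ϖ` divides both,
and replacing `u` by its image under `F ϖ` lowers the level by one. -/
theorem pow_dvd_sub_of_evalAt_eq (hF : IsFullFamily ϖ F q) (n : ℕ) {u : C}
    (hu : u ∈ torsionLevel (O := O) (F ϖ) (n + 1)) {α β : O}
    (h : evalAt (F α) u = evalAt (F β) u) : ϖ ^ (n + 1) ∣ α - β := by
  induction n generalizing u α β with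
  | zero =>
    by_cases hα : IsUnit α
    · exact hF.pow_dvd_sub_of_unit hu hα h
    by_cases hβ : IsUnit β
    · exact dvd_sub_comm.1 (hF.pow_dvd_sub_of_unit hu hβ h.symm)
    simpa using dvd_sub (dvd_of_not_isUnit hF.irreducible hα) (dvd_of_not_isUnit hF.irreducible hβ)
  | succ n ih =>
    by_cases hα : IsUnit α
    · exact hF.pow_dvd_sub_of_unit hu hα h
    by_cases hβ : IsUnit β
    · exact dvd_sub_comm.1 (hF.pow_dvd_sub_of_unit hu hβ h.symm)
    obtain ⟨α, rfl⟩ := dvd_of_not_isUnit hF.irreducible hα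
    obtain ⟨β, rfl⟩ := dvd_of_not_isUnit hF.irreducible hβ
    rw [mul_comm ϖ, mul_comm ϖ, ← hF.evalAt_evalAt _ _ hu.1, ← hF.evalAt_evalAt _ _ hu.1] at h
    rw [pow_succ', ← mul_sub]
    exact mul_dvd_mul_left ϖ (ih (evalAt_mem_torsionLevel (hF.constantCoeff_eq_zero ϖ) hu) h)

/-- The units of `O` act transitively on the points of exact level `n + 1`. -/
theorem torsionLevel_eq_orbit (hF : IsFullFamily ϖ F q) (hcard : q = Nat.card (ResidueField O))
    {n : ℕ} {u : C} (hu : u ∈ torsionLevel (O := O) (F ϖ) (n + 1)) :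
    torsionLevel (O := O) (F ϖ) (n + 1) = {v : C | ∃ α : Oˣ, v = evalAt (F α) u} := by
  have h0 := hF.constantCoeff_eq_zero
  have hzero (α : O) : evalAt (iter (F ϖ) (n + 1)) (evalAt (F α) u) = 0 := by
    rw [hF.evalAt_iter_comm _ _ hu.1, hu.2.1, evalAt_zero, h0, map_zero]
  obtain ⟨D, V, HD, hdeg, hnodup, hDz⟩ := exists_iter_zeros (C := C) (h0 ϖ)
    hF.irreducible_coeff_one hF.two_le hF.order_eq (n + 1)
  obtain ⟨hT, hfin⟩ := ncard_setOf_aeval_eq_zero HD.isDistinguishedAt.monic hnodup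
  rw [hdeg] at hT
  set T := {u : C | Polynomial.aeval u D = 0}
  -- Chosen representatives suffice: only injectivity on classes is needed, and both sides have `q ^
  -- (n + 1)` elements.
  let e : O ⧸ maximalIdeal O ^ (n + 1) → T := fun x =>
    ⟨evalAt (F x.out) u, (hDz _).2 ⟨hF.norm_lt_one _ hu.1, hzero _⟩⟩
  have hmem (x : O) : x ∈ maximalIdeal O ^ (n + 1) ↔ ϖ ^ (n + 1) ∣ x := by
    rw [hF.irreducible.maximalIdeal_eq, Ideal.span_singleton_pow, Ideal.mem_span_singleton]
  have hinj : Function.Injective e := by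
    intro x y hxy
    have h1 := hF.pow_dvd_sub_of_evalAt_eq n hu (congrArg Subtype.val hxy)
    rw [← hmem, ← Ideal.Quotient.mk_eq_mk_iff_sub_mem] at h1
    simpa using h1
  have : Finite T := hfin
  have hq : Nat.card (O ⧸ maximalIdeal O ^ (n + 1)) = q ^ (n + 1) := by
    have h1 := cardQuot_pow_of_prime (P := maximalIdeal O)
      (IsDiscreteValuationRing.not_a_field O) (i := n + 1)
    rw [Submodule.cardQuot_apply, Submodule.cardQuot_apply] at h1
    rw [h1, hcard]
    rfl
  have hsurj : Function.Surjective e := by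
    refine (hinj.bijective_of_nat_card_le ?_).2
    rw [hq, Nat.card_coe_set_eq, hT]
  ext v
  constructor
  · intro hv
    obtain ⟨x, hx⟩ := hsurj ⟨v, (hDz v).2 ⟨hv.1, hv.2.1⟩⟩
    have hx' : evalAt (F x.out) u = v := congrArg Subtype.val hx
    by_cases hun : IsUnit x.out
    · exact ⟨hun.unit, hx'.symm⟩
    exfalso
    -- A non-unit parameter factors through `F ϖ`, so iterate `n` already kills `v`.
    obtain ⟨β, hβ⟩ := dvd_of_not_isUnit hF.irreducible hun
    have h3 := hu.2.1
    refine hv.2.2 ?_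
    rw [← hx', hβ, mul_comm, ← hF.evalAt_evalAt _ _ hu.1,
      hF.evalAt_iter_comm _ _ (hF.norm_lt_one _ hu.1), Nat.add_sub_cancel,
      ← evalAt_comp _ (h0 ϖ) hu.1, ← iter_succ' (h0 ϖ), h3, evalAt_zero, h0, map_zero]
  · rintro ⟨α, rfl⟩
    refine ⟨hF.norm_lt_one _ hu.1, hzero _, fun h => hu.2.2 ?_⟩
    rw [hF.evalAt_iter_comm _ _ hu.1] at h
    have hi := norm_evalAt_lt_one (constantCoeff_iter (h0 ϖ) (n + 1 - 1)) hu.1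
    have h1 := congrArg (evalAt (F ↑α⁻¹)) h
    rwa [hF.evalAt_evalAt _ _ hi, Units.inv_mul, hF.apply_one, evalAt_X, evalAt_zero, h0,
      map_zero] at h1

end IsFullFamily

/-! ### Congruence level and the main theorem -/

section Level

variable {R : Type*} [CommRing R]

theorem mem_onePlus_iff {ϖ α : R} {n : ℕ} : α ∈ onePlus ϖ n ↔ ϖ ^ n ∣ α - 1 :=
  ⟨fun ⟨β, h⟩ => ⟨β, by rw [h, add_sub_cancel_left]⟩,
    fun ⟨β, h⟩ => ⟨β, by rw [← h, add_sub_cancel]⟩⟩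

theorem natCast_le_level_iff {ϖ α : R} {n : ℕ} : (n : ℕ∞) ≤ level ϖ α ↔ ϖ ^ n ∣ α - 1 := by
  constructor
  · intro h
    rcases Nat.eq_zero_or_pos n with rfl | hn
    · simp
    by_contra hnd
    have hle : level ϖ α ≤ ((n - 1 : ℕ) : ℕ∞) := by
      refine sSup_le ?_
      rintro m ⟨k, rfl, hk⟩
      rw [mem_onePlus_iff] at hk
      rw [Nat.cast_le]
      by_contra! hlt
      exact hnd ((pow_dvd_pow ϖ (by omega)).trans hk)
    have := Nat.cast_le.1 (h.trans hle)
    omega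
  · intro h
    exact le_sSup ⟨n, rfl, mem_onePlus_iff.2 h⟩

end Level

theorem wideg_eq_zero_iff {R : Type*} [CommRing R] (f : R⟦X⟧) :
    wideg f = 0 ↔ IsUnit (constantCoeff f) := by
  constructor
  · intro h
    have hne : {m : ℕ∞ | ∃ i : ℕ, m = (i : ℕ∞) ∧ IsUnit (coeff i f)}.Nonempty := by
      by_contra hemp
      rw [Set.not_nonempty_iff_eq_empty] at hemp
      rw [wideg, hemp, sInf_empty] at h
      exact ENat.top_ne_zero h
    obtain ⟨i, hi, hu⟩ := csInf_mem hne
    have h0 : (i : ℕ∞) = 0 := hi.symm.trans h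
    rw [Nat.cast_eq_zero] at h0
    subst h0
    simpa using hu
  · intro h
    exact le_antisymm (sInf_le ⟨0, rfl, by simpa using h⟩) bot_le

end LubinFamily

open LubinFamily in
theorem mainTheorem3 (p : ℕ) [Fact p.Prime]
    (K : Type*) [Field K] [Algebra ℚ_[p] K] [FiniteDimensional ℚ_[p] K]
    [Algebra ℤ_[p] K] [IsScalarTower ℤ_[p] ℚ_[p] K]
    [Algebra K ℂ_[p]] [IsScalarTower ℚ_[p] K ℂ_[p]]
    (ϖ : Integers p K) (hϖ : Irreducible ϖ)
    (F : Integers p K → PowerSeries (Integers p K))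
    (hF : IsCommutingFamily F)
    (hfull : wideg (F ϖ) = (residueCard p K : ℕ∞))
    (n : ℕ) (hn : 1 ≤ n) :
    (∀ u ∈ levelSet p (F ϖ) n, ∀ α : Integers p K,
        eval p (F α) u = u ↔ (n : ℕ∞) ≤ level ϖ α) ∧
      (∀ α : Integers p K, level ϖ α = (n : ℕ∞) →
        wideg (F α - PowerSeries.X) = ((residueCard p K ^ n : ℕ) : ℕ∞)) ∧
      (∀ u ∈ levelSet p (F ϖ) n,
        levelSet p (F ϖ) n = {v | ∃ α : (Integers p K)ˣ, v = eval p (F α) u}) := by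
  have := isDiscreteValuationRing_integers p K
  have := isAdicComplete_integers p K
  have hinj : Function.Injective (algebraMap (Integers p K) ℂ_[p]) :=
    (algebraMap K ℂ_[p]).injective.comp Subtype.val_injective
  have : FaithfulSMul (Integers p K) ℂ_[p] := (faithfulSMul_iff_algebraMap_injective _ _).2 hinj
  have : CharZero (Integers p K) :=
    (RingHom.charZero_iff hinj).2 inferInstance
  have hle (x : Integers p K) : ‖algebraMap (Integers p K) ℂ_[p] x‖ ≤ 1 :=
    (isIntegral_iff_norm_le_one p K x).1 x.2
  have : IsBounded (Integers p K) ℂ_[p] := ⟨hle, fun x hx => lt_of_le_of_ne (hle x) fun h =>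
    (IsLocalRing.mem_maximalIdeal _).1 hx ((isUnit_integers_iff p K x).2 h)⟩
  have horder := (wideg_eq_order (F ϖ)).symm.trans hfull
  -- `Nat.card` is 0 on infinite types; that value would make the constant coefficient of `F ϖ` a
  -- unit. So the residue field is finite, and `q ≥ 2`.
  have hne0 : residueCard p K ≠ 0 := by
    intro h
    rw [h, Nat.cast_zero, wideg_eq_zero_iff, hF.constantCoeff_eq_zero] at hfull
    exact not_isUnit_zero hfull
  have hne1 : 2 ≤ residueCard p K := by
    have : Finite (IsLocalRing.ResidueField (Integers p K)) := (Nat.card_ne_zero.1 hne0).2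
    exact Finite.one_lt_card
  have hfam : IsFullFamily ϖ F (residueCard p K) := ⟨hF, hϖ, hne1, horder⟩
  obtain ⟨n, rfl⟩ := Nat.exists_eq_add_of_le' hn
  refine ⟨fun u hu α => ?_, fun α hα => ?_, fun u hu => ?_⟩
  · rw [natCast_le_level_iff]
    exact hfam.fixed_iff hu α
  · refine hfam.wideg_sub_X ℂ_[p] (natCast_le_level_iff.1 hα.ge) fun h => ?_
    have h1 := (natCast_le_level_iff.2 h).trans hα.le
    have := Nat.cast_le.1 h1
    omega
  · exact hfam.torsionLevel_eq_orbit rfl hu
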